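/- Let $\Bbbk$ be a field and let $X$ be a noetherian separated scheme over $\Bbbk$. Let $\mathcal L$ be a Lie algebroid on $X$, i.e. a coherent $\mathcal O_X$-module with a $\Bbbk$-linear Lie bracket on its sections (compatible with restriction) and an $\mathcal O_X$-linear anchor $a\colon\mathcal L\to\Theta_X=\mathcal Der_{\Bbbk}(\mathcal O_X)$ that preserves brackets, such that $[s,ft]=f[s,t]+a(s)(f)\,t$; assume that $\mathcal L$ is locally free as an $\mathcal O_X$-module. A representation of $\mathcal L$ is an $\mathcal O_X$-module $\mathcal M$ (a sheaf, not assumed coherent) with an $\mathcal O_X$-linear map $\rho$ from $\mathcal L$ to the sheaf of $\Bbbk$-linear differential operators of order $\le 1$ on $\mathcal M$, compatible with restriction, such that $\rho(s)(fm)=f\rho(s)(m)+a(s)(f)\,m$ and $\rho([s,t])=\rho(s)\rho(t)-\rho(t)\rho(s)$. Morphisms of representations are the $\mathcal O_X$-linear maps that commute with the operators $\rho(s)$; they form the category $\operatorname{Rep}(\mathcal L)$. For a $(\Bbbk,A)$-Lie-Rinehart algebra $L$ with anchor $a$, let $A\oplus L$ be the $\Bbbk$-Lie algebra with bracket $[f\oplus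 x,g\oplus y]=(a(x)(g)-a(y)(f))\oplus[x,y]$, and let $\mathfrak U(L)$ be the quotient of its enveloping $\Bbbk$-algebra, with canonical map $\iota$, by the two-sided ideal generated by the elements $\iota(fu)-\iota(f)\iota(u)$ ($f\in A$, $u\in A\oplus L$) and $\iota(1_A)-1$. For $V\subset X$ open let $\mathfrak U(\mathcal L)(V)$ be the ring of families $(u_U)_U$, indexed by the affine open subsets $U\subset V$, with $u_U\in\mathfrak U(\mathcal L(U))$, that are compatible with the restriction maps $\mathfrak U(\mathcal L(U))\to\mathfrak U(\mathcal L(W))$ for $W\subset U$. Then: 1. $\mathfrak U(\mathcal L)$ is a sheaf of rings on $X$, and for every affine open $U\subset X$ the natural map $\mathfrak U(\mathcal L)(U)\to\mathfrak U(\mathcal L(U))$ is bijective. 2. The functor from the category of sheaves of left $\mathfrak U(\mathcal L)$-modules to $\operatorname{Rep}(\mathcal L)$ that sends $\mathcal N$ to its underlying $\mathcal O_X$-module (through $\mathcal O_X\to\mathfrak U(\mathcal L)$) with $\rho(s)(n)=s\cdot n$ is an equivalence of categories. 3. This functor restricts to an equivalence between the left $\mathfrak U(\mathcal L)$-modules that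 are coherent as $\mathcal O_X$-modules and the representations of $\mathcal L$ on coherent $\mathcal O_X$-modules. -/

import Mathlib

open CategoryTheory AlgebraicGeometry TopologicalSpace Opposite

universe u v w

set_option linter.unusedSectionVars false

noncomputable section

/-! ### The universal enveloping algebra of a Lie-Rinehart algebra -/

namespace LieRinehart

section Algebraic

variable (k : Type u) (A : Type v) (L : Type w) [CommRing k] [CommRing A] [Algebra k A]
  [LieRing L] [Module A L] [LieRingModule L A] [LieAlgebra k L]

/-- The direct sum `L̄ = A ⊕ L`, with the Lie bracket
`[f ⊕ x, g ⊕ y] = (a(x)(g) - a(y)(f)) ⊕ [x, y]`. The anchor `a(x)(f)` of a Lie-Rinehart algebra is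
written `⁅x, f⁆` in Mathlib. -/
@[ext]
structure Ext (A : Type v) (L : Type w) where
  /-- the component in `A` -/
  fst : A
  /-- the component in `L` -/
  snd : L

namespace Ext

variable {A L}

/-- The bijection of `A ⊕ L` with the product. -/
def equivProd (A : Type v) (L : Type w) : Ext A L ≃ A × L where
  toFun u := (u.fst, u.snd)
  invFun p := ⟨p.1, p.2⟩

instance : AddCommGroup (Ext A L) := (equivProd A L).addCommGroup

instance : Module A (Ext A L) := (equivProd A L).module A

@[simp] lemma add_fst (u v : Ext A L) : (u + v).fst = u.fst + v.fst := rfl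
@[simp] lemma add_snd (u v : Ext A L) : (u + v).snd = u.snd + v.snd := rfl
@[simp] lemma zero_fst : (0 : Ext A L).fst = 0 := rfl
@[simp] lemma zero_snd : (0 : Ext A L).snd = 0 := rfl
@[simp] lemma smul_fst (f : A) (u : Ext A L) : (f • u).fst = f * u.fst := rfl
@[simp] lemma smul_snd (f : A) (u : Ext A L) : (f • u).snd = f • u.snd := rfl

instance : Bracket (Ext A L) (Ext A L) :=
  ⟨fun u v => ⟨⁅u.snd, v.fst⁆ - ⁅v.snd, u.fst⁆, ⁅u.snd, v.snd⁆⟩⟩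

@[simp] lemma lie_fst (u v : Ext A L) : ⁅u, v⁆.fst = ⁅u.snd, v.fst⁆ - ⁅v.snd, u.fst⁆ := rfl
@[simp] lemma lie_snd (u v : Ext A L) : ⁅u, v⁆.snd = ⁅u.snd, v.snd⁆ := rfl

instance : LieRing (Ext A L) where
  add_lie u v w := by
    ext
    · simp; abel
    · simp
  lie_add u v w := by
    ext
    · simp; abel
    · simp
  lie_self u := by ext <;> simp
  leibniz_lie u v w := by
    ext
    · simp; abel
    · simp

variable [LieRinehartRing A L] [LieRinehartAlgebra k A L]

instance : Module k (Ext A L) := (equivProd A L).module k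

@[simp] lemma smul_fst' (c : k) (u : Ext A L) : (c • u).fst = c • u.fst := rfl
@[simp] lemma smul_snd' (c : k) (u : Ext A L) : (c • u).snd = c • u.snd := rfl

instance : LieAlgebra k (Ext A L) where
  lie_smul c u v := by
    ext
    · have h₁ := LieModule.lie_smul (R := k) c u.snd v.fst
      have h₂ := LieModule.smul_lie (R := k) c v.snd u.fst
      simp [smul_sub, h₁, h₂]
    · simp

end Ext

variable [LieRinehartRing A L] [LieRinehartAlgebra k A L]

/-- The relations imposed on the enveloping algebra of the `k`-Lie algebra `A ⊕ L`:
`ι(f u) = ι(f) ι(u)` for `f ∈ A`, `u ∈ A ⊕ L`, and `ι(1_A) = 1`.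

(In terms of the subalgebra without unit generated by `ι(A ⊕ L)`: modulo the first
family of relations `ι(1_A)` is a two-sided unit of that subalgebra, and the second relation is the
identification of this unit with the unit of the enveloping algebra.) -/
inductive EnvRel : UniversalEnvelopingAlgebra k (Ext A L) →
    UniversalEnvelopingAlgebra k (Ext A L) → Prop
  | smul (f : A) (u : Ext A L) :
      EnvRel (UniversalEnvelopingAlgebra.ι k (f • u))
        (UniversalEnvelopingAlgebra.ι k (⟨f, 0⟩ : Ext A L) * UniversalEnvelopingAlgebra.ι k u)
  | one : EnvRel (UniversalEnvelopingAlgebra.ι k (⟨1, 0⟩ : Ext A L)) 1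

/-- Rinehart's universal enveloping algebra `𝔘(L)` of the `(k, A)`-Lie-Rinehart algebra `L`:
the quotient of the enveloping algebra of `A ⊕ L` by the two-sided ideal generated
by the relations `EnvRel`. -/
def Env : Type (max u v w) := RingQuot (EnvRel k A L)

namespace Env

instance : Ring (Env k A L) := inferInstanceAs (Ring (RingQuot (EnvRel k A L)))

instance : Algebra k (Env k A L) := inferInstanceAs (Algebra k (RingQuot (EnvRel k A L)))

/-- The quotient map from the enveloping algebra of `A ⊕ L`. -/
def mk : UniversalEnvelopingAlgebra k (Ext A L) →ₐ[k] Env k A L :=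
  RingQuot.mkAlgHom k (EnvRel k A L)

attribute [local instance 100] LieRing.ofAssociativeRing in
/-- The natural map `ι : A ⊕ L → 𝔘(L)`. -/
def ι : Ext A L →ₗ[k] Env k A L :=
  (mk k A L).toLinearMap ∘ₗ (UniversalEnvelopingAlgebra.ι k : Ext A L →ₗ⁅k⁆ _).toLinearMap

attribute [local instance 100] LieRing.ofAssociativeRing in
lemma ι_apply (u : Ext A L) : ι k A L u = mk k A L (UniversalEnvelopingAlgebra.ι k u) := rfl

lemma ι_smul (f : A) (u : Ext A L) : ι k A L (f • u) = ι k A L ⟨f, 0⟩ * ι k A L u := by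
  simp only [ι_apply, ← map_mul]
  exact RingQuot.mkAlgHom_rel k (EnvRel.smul f u)

lemma ι_one : ι k A L ⟨1, 0⟩ = 1 := by
  rw [ι_apply, ← map_one (mk k A L)]
  exact RingQuot.mkAlgHom_rel k EnvRel.one

attribute [local instance 100] LieRing.ofAssociativeRing in
lemma ι_lie (u v : Ext A L) :
    ι k A L ⁅u, v⁆ = ι k A L u * ι k A L v - ι k A L v * ι k A L u := by
  simp only [ι_apply, LieHom.map_lie, LieRing.of_associative_ring_bracket, map_sub, map_mul]

/-- The ring homomorphism `A → 𝔘(L)`. -/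
def ofRing : A →+* Env k A L where
  toFun f := ι k A L ⟨f, 0⟩
  map_one' := ι_one k A L
  map_mul' f g := by
    rw [← ι_smul]
    congr 1
    ext <;> simp
  map_zero' := map_zero (ι k A L)
  map_add' f g := by
    rw [← map_add]
    congr 1
    ext <;> simp

/-- The additive map `L → 𝔘(L)`. -/
def ofLie : L →+ Env k A L where
  toFun s := ι k A L ⟨0, s⟩
  map_zero' := map_zero (ι k A L)
  map_add' s t := by
    rw [← map_add]
    congr 1
    ext <;> simp

lemma ofLie_smul (f : A) (s : L) : ofLie k A L (f • s) = ofRing k A L f * ofLie k A L s := by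
  change ι k A L _ = ι k A L _ * ι k A L _
  rw [← ι_smul]
  congr 1
  ext <;> simp

lemma ofLie_mul_ofRing (s : L) (f : A) :
    ofLie k A L s * ofRing k A L f = ofRing k A L f * ofLie k A L s + ofRing k A L ⁅s, f⁆ := by
  have h := ι_lie k A L ⟨0, s⟩ ⟨f, 0⟩
  have h' : (⁅(⟨0, s⟩ : Ext A L), ⟨f, 0⟩⁆ : Ext A L) = ⟨⁅s, f⁆, 0⟩ := by ext <;> simp
  rw [h'] at h
  change ι k A L _ * ι k A L _ = ι k A L _ * ι k A L _ + ι k A L _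
  rw [h]
  abel

lemma ofLie_lie (s t : L) : ofLie k A L ⁅s, t⁆ =
    ofLie k A L s * ofLie k A L t - ofLie k A L t * ofLie k A L s := by
  have h := ι_lie k A L ⟨0, s⟩ ⟨0, t⟩
  have h' : (⁅(⟨0, s⟩ : Ext A L), ⟨0, t⟩⁆ : Ext A L) = ⟨0, ⁅s, t⁆⟩ := by ext <;> simp
  rw [h'] at h
  exact h

variable {k A L}

attribute [local instance 100] LieRing.ofAssociativeRing in
lemma algHom_ext {B : Type*} [Ring B] [Algebra k B] {φ ψ : Env k A L →ₐ[k] B}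
    (h : ∀ u, φ (ι k A L u) = ψ (ι k A L u)) : φ = ψ := by
  refine RingQuot.ringQuot_ext' _ _ _ ?_
  ext u
  exact h u

variable {A' : Type v} {L' : Type w} [CommRing A'] [Algebra k A'] [LieRing L'] [Module A' L']
  [LieRingModule L' A'] [LieAlgebra k L'] [LieRinehartRing A' L'] [LieRinehartAlgebra k A' L']
  {A'' : Type v} {L'' : Type w} [CommRing A''] [Algebra k A''] [LieRing L''] [Module A'' L'']
  [LieRingModule L'' A''] [LieAlgebra k L''] [LieRinehartRing A'' L'']
  [LieRinehartAlgebra k A'' L'']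

/-- The map `A ⊕ L → A' ⊕ L'` induced by a morphism of Lie-Rinehart algebras. -/
def extMap {σ : A →ₐ[k] A'} (F : LieRinehartAlgebra.Hom σ L L') : Ext A L →ₗ⁅k⁆ Ext A' L' where
  toFun u := ⟨σ u.fst, F u.snd⟩
  map_add' u v := by ext <;> simp
  map_smul' c u := by ext <;> simp
  map_lie' {u v} := by ext <;> simp [F.apply_lie]

@[simp] lemma extMap_fst {σ : A →ₐ[k] A'} (F : LieRinehartAlgebra.Hom σ L L') (u : Ext A L) :
    (extMap F u).fst = σ u.fst := rfl
@[simp] lemma extMap_snd {σ : A →ₐ[k] A'} (F : LieRinehartAlgebra.Hom σ L L') (u : Ext A L) :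
    (extMap F u).snd = F u.snd := rfl

attribute [local instance 100] LieRing.ofAssociativeRing in
/-- The functoriality of the universal enveloping algebra: the homomorphism `𝔘(L) → 𝔘(L')`
induced by a morphism of Lie-Rinehart algebras. -/
def map {σ : A →ₐ[k] A'} (F : LieRinehartAlgebra.Hom σ L L') : Env k A L →ₐ[k] Env k A' L' :=
  RingQuot.liftAlgHom k ⟨(mk k A' L').comp
    (UniversalEnvelopingAlgebra.lift k ((UniversalEnvelopingAlgebra.ι k).comp (extMap F))), by
      rintro _ _ (⟨f, u⟩ | _)
      · have h : extMap F (f • u) = σ f • extMap F u := by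
          ext <;> simp [F.map_smul_apply]
        have h' : extMap F ⟨f, 0⟩ = ⟨σ f, 0⟩ := by ext <;> simp
        simp only [AlgHom.comp_apply, map_mul, UniversalEnvelopingAlgebra.lift_ι_apply,
          LieHom.comp_apply, h, h']
        exact ι_smul k A' L' (σ f) (extMap F u)
      · have h' : extMap F (⟨1, 0⟩ : Ext A L) = ⟨1, 0⟩ := by ext <;> simp
        simp only [AlgHom.comp_apply, map_one, UniversalEnvelopingAlgebra.lift_ι_apply,
          LieHom.comp_apply, h']
        exact ι_one k A' L'⟩

attribute [local instance 100] LieRing.ofAssociativeRing in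
@[simp]
lemma map_ι {σ : A →ₐ[k] A'} (F : LieRinehartAlgebra.Hom σ L L') (u : Ext A L) :
    map F (ι k A L u) = ι k A' L' (extMap F u) := by
  refine (RingQuot.liftAlgHom_mkAlgHom_apply _ _ _ _).trans ?_
  exact congrArg (mk k A' L') (UniversalEnvelopingAlgebra.lift_ι_apply k _ u)

@[simp]
lemma map_ofRing {σ : A →ₐ[k] A'} (F : LieRinehartAlgebra.Hom σ L L') (f : A) :
    map F (ofRing k A L f) = ofRing k A' L' (σ f) := by
  refine (map_ι F _).trans (congrArg (ι k A' L') ?_)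
  ext <;> simp

@[simp]
lemma map_ofLie {σ : A →ₐ[k] A'} (F : LieRinehartAlgebra.Hom σ L L') (s : L) :
    map F (ofLie k A L s) = ofLie k A' L' (F s) := by
  refine (map_ι F _).trans (congrArg (ι k A' L') ?_)
  ext <;> simp

lemma map_of_eq_id {σ : A →ₐ[k] A} (F : LieRinehartAlgebra.Hom σ L L)
    (hσ : ∀ f, σ f = f) (hF : ∀ s, F s = s) (x : Env k A L) : map F x = x := by
  have h : map F = AlgHom.id k _ := algHom_ext fun u => by
    rw [map_ι]
    exact congrArg _ (Ext.ext (hσ _) (hF _))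
  rw [h, AlgHom.id_apply]

lemma map_map_of_eq {σ : A →ₐ[k] A'} {τ : A' →ₐ[k] A''} {υ : A →ₐ[k] A''}
    (F : LieRinehartAlgebra.Hom σ L L') (G : LieRinehartAlgebra.Hom τ L' L'')
    (H : LieRinehartAlgebra.Hom υ L L'')
    (hσ : ∀ f, τ (σ f) = υ f) (hF : ∀ s, G (F s) = H s) (x : Env k A L) :
    map G (map F x) = map H x := by
  have h : (map G).comp (map F) = map H := algHom_ext fun u => by
    rw [AlgHom.comp_apply, map_ι, map_ι, map_ι]
    exact congrArg _ (Ext.ext (hσ _) (hF _))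
  exact congrArg (fun φ => φ x) h

end Env

end Algebraic

end LieRinehart

/-! ### Lie algebroids on schemes and their representations -/

/-- The `k`-algebra structure on the sections of the structure sheaf of a `k`-scheme. -/
instance schemeSectionsAlgebra (k : Type u) [Field k] (X : Scheme.{u}) [X.Over (Spec (.of k))]
    (V : X.Opens) : Algebra k Γ(X, V) :=
  ((Scheme.ΓSpecIso (.of k)).inv ≫ (X ↘ Spec (.of k)).appTop ≫
    X.presheaf.map (homOfLE le_top : V ⟶ ⊤).op).hom.toAlgebra

/-- The restriction homomorphism of the structure sheaf of a `k`-scheme, as a homomorphism of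
`k`-algebras. -/
def schemeRestrict (k : Type u) [Field k] {X : Scheme.{u}} [X.Over (Spec (.of k))]
    {U V : X.Opens} (i : U ⟶ V) : Γ(X, V) →ₐ[k] Γ(X, U) where
  toRingHom := (X.presheaf.map i.op).hom
  commutes' c := by
    change (X.presheaf.map i.op).hom (((Scheme.ΓSpecIso (.of k)).inv ≫
      (X ↘ Spec (.of k)).appTop ≫ X.presheaf.map (homOfLE le_top : V ⟶ ⊤).op).hom c) =
      ((Scheme.ΓSpecIso (.of k)).inv ≫ (X ↘ Spec (.of k)).appTop ≫
        X.presheaf.map (homOfLE le_top : U ⟶ ⊤).op).hom c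
    rw [← CommRingCat.comp_apply, Category.assoc, Category.assoc, ← X.presheaf.map_comp]
    rfl

/-- A Lie algebroid on the `k`-scheme `X`: a coherent `𝒪_X`-module with a `k`-linear Lie bracket
on its sections and an anchor, subject to the Leibniz rule. (On a noetherian scheme
an `𝒪_X`-module is coherent if and only if it is of finite presentation.)

The anchor is a morphism of `𝒪_X`-modules from `carrier` to the sheaf
`V ↦ {k-linear derivations of the sheaf 𝒪_V}`. Such a derivation is a family of derivations of the
rings `Γ(X, W)`, for `W ⊆ V`, compatible with restriction. As the anchor
commutes with restrictions, the member with index `W` of the family attached to a section `s` on `V`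
is the derivation of `Γ(X, W)` attached to `s|_W`, so that the anchor is given by
`Γ(X, V)`-linear maps from the sections on `V` to the derivations of `Γ(X, V)`, with the
compatibility `anchor_restrict`. -/
structure LieAlgebroid (k : Type u) [Field k] (X : Scheme.{u}) [X.Over (Spec (.of k))] where
  /-- the underlying `𝒪_X`-module -/
  carrier : X.Modules
  coherent : SheafOfModules.IsFinitePresentation (R := X.ringCatSheaf) carrier
  /-- the Lie bracket of sections -/
  bracket (V : X.Opens) : Γ(carrier, V) → Γ(carrier, V) → Γ(carrier, V)
  bracket_restrict {U V : X.Opens} (i : U ⟶ V) (s t : Γ(carrier, V)) :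
    carrier.presheaf.map i.op (bracket V s t) =
      bracket U (carrier.presheaf.map i.op s) (carrier.presheaf.map i.op t)
  add_bracket (V : X.Opens) (s s' t : Γ(carrier, V)) :
    bracket V (s + s') t = bracket V s t + bracket V s' t
  bracket_add (V : X.Opens) (s t t' : Γ(carrier, V)) :
    bracket V s (t + t') = bracket V s t + bracket V s t'
  bracket_smul (V : X.Opens) (c : k) (s t : Γ(carrier, V)) :
    bracket V s (algebraMap k Γ(X, V) c • t) = algebraMap k Γ(X, V) c • bracket V s t
  bracket_self (V : X.Opens) (s : Γ(carrier, V)) : bracket V s s = 0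
  jacobi (V : X.Opens) (s t r : Γ(carrier, V)) :
    bracket V s (bracket V t r) = bracket V (bracket V s t) r + bracket V t (bracket V s r)
  /-- the anchor -/
  anchor (V : X.Opens) : Γ(carrier, V) →ₗ[Γ(X, V)] Derivation k Γ(X, V) Γ(X, V)
  anchor_restrict {U V : X.Opens} (i : U ⟶ V) (s : Γ(carrier, V)) (f : Γ(X, V)) :
    X.presheaf.map i.op (anchor V s f) =
      anchor U (carrier.presheaf.map i.op s) (X.presheaf.map i.op f)
  anchor_bracket (V : X.Opens) (s t : Γ(carrier, V)) :
    anchor V (bracket V s t) = ⁅anchor V s, anchor V t⁆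
  leibniz (V : X.Opens) (s t : Γ(carrier, V)) (f : Γ(X, V)) :
    bracket V s (f • t) = f • bracket V s t + anchor V s f • t

namespace LieAlgebroid

variable {k : Type u} [Field k] {X : Scheme.{u}} [X.Over (Spec (.of k))]

section Sections

variable (ℒ : LieAlgebroid k X)

/-- The sections of a Lie algebroid on an open subset. -/
abbrev Sections (V : X.Opens) : Type u := Γ(ℒ.carrier, V)

variable (V : X.Opens)

instance : LieRing (ℒ.Sections V) where
  bracket := ℒ.bracket V
  add_lie := ℒ.add_bracket V
  lie_add := ℒ.bracket_add V
  lie_self := ℒ.bracket_self V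
  leibniz_lie := ℒ.jacobi V

instance : Module k (ℒ.Sections V) := Module.compHom _ (algebraMap k Γ(X, V))

instance : LieAlgebra k (ℒ.Sections V) where
  lie_smul c s t := ℒ.bracket_smul V c s t

/-- The action of the sections of a Lie algebroid on functions, through the anchor. -/
instance : LieRingModule (ℒ.Sections V) Γ(X, V) where
  bracket s f := ℒ.anchor V s f
  add_lie s t f := by
    change ℒ.anchor V (s + t) f = _
    rw [map_add]; rfl
  lie_add s f g := map_add (ℒ.anchor V s) f g
  leibniz_lie s t f := by
    change ℒ.anchor V s (ℒ.anchor V t f) =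
      ℒ.anchor V (ℒ.bracket V s t) f + ℒ.anchor V t (ℒ.anchor V s f)
    rw [ℒ.anchor_bracket, Derivation.commutator_apply]
    abel

instance : LieRinehartRing Γ(X, V) (ℒ.Sections V) where
  lie_smul_eq_mul' f g s := by
    change ℒ.anchor V (f • s) g = f * ℒ.anchor V s g
    rw [map_smul]; rfl
  leibniz_mul_right' s f g := by
    change ℒ.anchor V s (f * g) = f • ℒ.anchor V s g + ℒ.anchor V s f * g
    rw [Derivation.leibniz, smul_eq_mul, smul_eq_mul, mul_comm g]
  leibniz_smul_right' s t f := ℒ.leibniz V s t f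

/-- The sections of a Lie algebroid on `V` are a `(k, Γ(X, V))`-Lie-Rinehart algebra. -/
instance : LieRinehartAlgebra k Γ(X, V) (ℒ.Sections V) where
  smul_assoc c f s := by
    change (c • f) • s = algebraMap k Γ(X, V) c • (f • s)
    rw [Algebra.smul_def, mul_smul]
  smul_lie c s f := by
    change ℒ.anchor V (algebraMap k Γ(X, V) c • s) f = c • ℒ.anchor V s f
    rw [map_smul, Algebra.smul_def]; rfl
  lie_smul c s f := (ℒ.anchor V s).map_smul c f

variable {V}

/-- The restriction of sections, as a morphism of Lie-Rinehart algebras. -/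
def restrict {U : X.Opens} (i : U ⟶ V) :
    LieRinehartAlgebra.Hom (schemeRestrict k i) (ℒ.Sections V) (ℒ.Sections U) where
  toFun s := ℒ.carrier.presheaf.map i.op s
  map_add' s t := map_add _ s t
  map_smul' c s := by
    refine (ℒ.carrier.map_smul i _ s).trans ?_
    exact congrArg (· • ℒ.carrier.presheaf.map i.op s) ((schemeRestrict k i).commutes c)
  map_lie' {s t} := ℒ.bracket_restrict i s t
  map_smul_apply' f s := ℒ.carrier.map_smul i f s
  apply_lie' f s := ℒ.anchor_restrict i s f

end Sections

/-- A representation of the Lie algebroid `ℒ` on an `𝒪_X`-module `ℳ` (not required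
to be coherent): an `𝒪_X`-linear morphism `ρ` from `ℒ` to the sheaf of `k`-linear first-order
differential operators on `ℳ` with scalar symbol, which is compatible with the brackets
and for which the symbol of `ρ(s)` is the anchor of `s`.

As for the anchor of a Lie algebroid, the morphism is given by operators `ρ(s)` on `Γ(ℳ, V)`, for
the sections `s` on `V`, which are compatible with restriction. That `ρ(s)` is
`k`-linear follows from its additivity and the rule `leibniz`, as derivations vanish on `k`. -/
structure Rep (ℒ : LieAlgebroid k X) where
  /-- the underlying `𝒪_X`-module -/
  carrier : X.Modules
  /-- the action of the sections of `ℒ` -/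
  ρ (V : X.Opens) : Γ(ℒ.carrier, V) →+ Γ(carrier, V) →+ Γ(carrier, V)
  restrict {U V : X.Opens} (i : U ⟶ V) (s : Γ(ℒ.carrier, V)) (m : Γ(carrier, V)) :
    carrier.presheaf.map i.op (ρ V s m) =
      ρ U (ℒ.carrier.presheaf.map i.op s) (carrier.presheaf.map i.op m)
  smul (V : X.Opens) (f : Γ(X, V)) (s : Γ(ℒ.carrier, V)) (m : Γ(carrier, V)) :
    ρ V (f • s) m = f • ρ V s m
  leibniz (V : X.Opens) (s : Γ(ℒ.carrier, V)) (f : Γ(X, V)) (m : Γ(carrier, V)) :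
    ρ V s (f • m) = f • ρ V s m + ℒ.anchor V s f • m
  bracket (V : X.Opens) (s t : Γ(ℒ.carrier, V)) (m : Γ(carrier, V)) :
    ρ V (ℒ.bracket V s t) m = ρ V s (ρ V t m) - ρ V t (ρ V s m)

namespace Rep

variable {ℒ : LieAlgebroid k X}

/-- A morphism of representations: a morphism of `𝒪_X`-modules which commutes with the action of
the sections of `ℒ`. -/
@[ext]
structure Hom (M N : ℒ.Rep) where
  /-- the underlying morphism of `𝒪_X`-modules -/
  hom : M.carrier ⟶ N.carrier
  comm (V : X.Opens) (s : Γ(ℒ.carrier, V)) (m : Γ(M.carrier, V)) :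
    N.ρ V s (hom.app V m) = hom.app V (M.ρ V s m)

/-- The category `Rep(ℒ)`. -/
instance : Category ℒ.Rep where
  Hom := Hom
  id M := { hom := 𝟙 M.carrier, comm := fun _ _ _ => rfl }
  comp φ ψ :=
    { hom := φ.hom ≫ ψ.hom
      comm := fun V s m => by
        change _ = ψ.hom.app V (φ.hom.app V _)
        rw [← φ.comm, ← ψ.comm]
        rfl }
  id_comp φ := Hom.ext (Category.id_comp φ.hom)
  comp_id φ := Hom.ext (Category.comp_id φ.hom)
  assoc φ ψ χ := Hom.ext (Category.assoc φ.hom ψ.hom χ.hom)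

variable (ℒ) in
/-- The functor which sends a representation to its underlying `𝒪_X`-module. -/
def forget : ℒ.Rep ⥤ X.Modules where
  obj M := M.carrier
  map φ := φ.hom

variable (ℒ) in
/-- The representations of `ℒ` on coherent `𝒪_X`-modules. -/
def isCoherent : ObjectProperty ℒ.Rep :=
  fun M => SheafOfModules.IsFinitePresentation (R := X.ringCatSheaf) M.carrier

end Rep

/-! ### The universal enveloping algebroid and its modules -/

section Enveloping

variable (ℒ : LieAlgebroid k X)

/-- Rinehart's enveloping algebra `𝔘(ℒ(U))` of the `(k, Γ(X, U))`-Lie-Rinehart algebra `ℒ(U)`. -/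
abbrev EnvSections (U : X.Opens) : Type u := LieRinehart.Env k Γ(X, U) (ℒ.Sections U)

/-- The homomorphism `𝔘(ℒ(V)) → 𝔘(ℒ(U))` induced by restriction. -/
def envRestrict {U V : X.Opens} (i : U ⟶ V) : ℒ.EnvSections V →ₐ[k] ℒ.EnvSections U :=
  LieRinehart.Env.map (ℒ.restrict i)

/-- The sections of `𝔘(ℒ)` on an open subset `V`, obtained by gluing: the families of elements
`u_U ∈ 𝔘(ℒ(U))`, for the affine open subsets `U` of `V`, which are compatible with restriction. -/
def envGlued (V : X.Opens) :
    Subring (∀ U : {U : X.affineOpens // U.1 ≤ V}, ℒ.EnvSections U.1.1) where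
  carrier := {u | ∀ (U W : {U : X.affineOpens // U.1 ≤ V}) (i : W.1.1 ⟶ U.1.1),
    ℒ.envRestrict i (u U) = u W}
  zero_mem' _ _ _ := map_zero _
  one_mem' _ _ _ := map_one _
  add_mem' hu hv U W i := by
    rw [Pi.add_apply, map_add, hu U W i, hv U W i, Pi.add_apply]
  mul_mem' hu hv U W i := by
    rw [Pi.mul_apply, map_mul, hu U W i, hv U W i, Pi.mul_apply]
  neg_mem' hu U W i := by
    rw [Pi.neg_apply, map_neg, hu U W i, Pi.neg_apply]

/-- The restriction of families to the affine open subsets of a smaller open subset. -/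
def envGluedRestrict {V V' : X.Opens} (h : V' ≤ V) : ℒ.envGlued V →+* ℒ.envGlued V' where
  toFun u := ⟨fun U => u.1 ⟨U.1, U.2.trans h⟩, fun U W i =>
    u.2 ⟨U.1, U.2.trans h⟩ ⟨W.1, W.2.trans h⟩ i⟩
  map_zero' := rfl
  map_one' := rfl
  map_add' _ _ := rfl
  map_mul' _ _ := rfl

/-- The universal enveloping algebroid `𝔘(ℒ)`, as a presheaf of rings on `X`. -/
def envPresheaf : (X.Opens)ᵒᵖ ⥤ RingCat.{u} where
  obj V := RingCat.of (ℒ.envGlued V.unop)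
  map i := RingCat.ofHom (ℒ.envGluedRestrict i.unop.le)

/-- The evaluation `𝔘(ℒ)(U) → 𝔘(ℒ(U))` for an affine open subset `U`. -/
def envEval (U : X.affineOpens) : ℒ.envGlued U.1 →+* ℒ.EnvSections U.1 :=
  (Pi.evalRingHom _ (⟨U, le_rfl⟩ : {W : X.affineOpens // W.1 ≤ U.1})).comp (ℒ.envGlued U.1).subtype

/-- The homomorphism `Γ(X, V) → 𝔘(ℒ)(V)`. -/
def envOfRing (V : X.Opens) : Γ(X, V) →+* ℒ.envGlued V :=
  (RingHom.pi fun U : {U : X.affineOpens // U.1 ≤ V} =>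
    (LieRinehart.Env.ofRing k Γ(X, U.1.1) (ℒ.Sections U.1.1)).comp
      (X.presheaf.map (homOfLE U.2).op).hom).codRestrict _ fun f U W i => by
    refine (LieRinehart.Env.map_ofRing (ℒ.restrict i) _).trans (congrArg _ ?_)
    change (X.presheaf.map i.op).hom ((X.presheaf.map (homOfLE U.2).op).hom f) =
      (X.presheaf.map (homOfLE W.2).op).hom f
    rw [← CommRingCat.comp_apply, ← X.presheaf.map_comp]
    rfl

/-- The map `ℒ(V) → 𝔘(ℒ)(V)`. -/
def envOfLie (V : X.Opens) : ℒ.Sections V →+ ℒ.envGlued V where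
  toFun s := ⟨fun U => LieRinehart.Env.ofLie k Γ(X, U.1.1) (ℒ.Sections U.1.1)
      (ℒ.restrict (homOfLE U.2) s), fun U W i => by
    refine (LieRinehart.Env.map_ofLie (ℒ.restrict i) _).trans (congrArg _ ?_)
    change ℒ.carrier.presheaf.map i.op (ℒ.carrier.presheaf.map (homOfLE U.2).op s) =
      ℒ.carrier.presheaf.map (homOfLE W.2).op s
    rw [← ConcreteCategory.comp_apply, ← ℒ.carrier.presheaf.map_comp]
    rfl⟩
  map_zero' := by
    ext U
    change LieRinehart.Env.ofLie _ _ _ (ℒ.carrier.presheaf.map _ 0) = 0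
    rw [map_zero, map_zero]
  map_add' s t := by
    ext U
    change LieRinehart.Env.ofLie _ _ _ (ℒ.carrier.presheaf.map _ (s + t)) = _
    rw [map_add, map_add]
    rfl

lemma envOfLie_smul (V : X.Opens) (f : Γ(X, V)) (s : ℒ.Sections V) :
    ℒ.envOfLie V (f • s) = ℒ.envOfRing V f * ℒ.envOfLie V s := by
  ext U
  refine Eq.trans ?_ (LieRinehart.Env.ofLie_smul k Γ(X, U.1.1) (ℒ.Sections U.1.1) _ _)
  exact congrArg (LieRinehart.Env.ofLie k Γ(X, U.1.1) (ℒ.Sections U.1.1))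
    (ℒ.carrier.map_smul (homOfLE U.2) f s)

lemma envOfLie_mul_envOfRing (V : X.Opens) (s : ℒ.Sections V) (f : Γ(X, V)) :
    ℒ.envOfLie V s * ℒ.envOfRing V f =
      ℒ.envOfRing V f * ℒ.envOfLie V s + ℒ.envOfRing V (ℒ.anchor V s f) := by
  ext U
  refine (LieRinehart.Env.ofLie_mul_ofRing k Γ(X, U.1.1) (ℒ.Sections U.1.1) _ _).trans ?_
  exact congrArg (fun g => (ℒ.envOfRing V f * ℒ.envOfLie V s).1 U +
    LieRinehart.Env.ofRing k Γ(X, U.1.1) (ℒ.Sections U.1.1) g)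
    (ℒ.anchor_restrict (homOfLE U.2) s f).symm

lemma envOfLie_bracket (V : X.Opens) (s t : ℒ.Sections V) :
    ℒ.envOfLie V (ℒ.bracket V s t) =
      ℒ.envOfLie V s * ℒ.envOfLie V t - ℒ.envOfLie V t * ℒ.envOfLie V s := by
  ext U
  refine Eq.trans ?_ (LieRinehart.Env.ofLie_lie k Γ(X, U.1.1) (ℒ.Sections U.1.1) _ _)
  exact congrArg (LieRinehart.Env.ofLie k Γ(X, U.1.1) (ℒ.Sections U.1.1))
    (ℒ.bracket_restrict (homOfLE U.2) s t)

lemma envGluedRestrict_envOfRing {V V' : X.Opens} (i : V' ⟶ V) (f : Γ(X, V)) :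
    ℒ.envGluedRestrict i.le (ℒ.envOfRing V f) = ℒ.envOfRing V' (X.presheaf.map i.op f) := by
  ext U
  refine congrArg (LieRinehart.Env.ofRing k Γ(X, U.1.1) (ℒ.Sections U.1.1)) ?_
  change X.presheaf.map _ f = X.presheaf.map _ (X.presheaf.map i.op f)
  rw [← CommRingCat.comp_apply, ← X.presheaf.map_comp]
  rfl

lemma envGluedRestrict_envOfLie {V V' : X.Opens} (i : V' ⟶ V) (s : ℒ.Sections V) :
    ℒ.envGluedRestrict i.le (ℒ.envOfLie V s) =
      ℒ.envOfLie V' (ℒ.carrier.presheaf.map i.op s) := by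
  ext U
  refine congrArg (LieRinehart.Env.ofLie k Γ(X, U.1.1) (ℒ.Sections U.1.1)) ?_
  change ℒ.carrier.presheaf.map _ s =
    ℒ.carrier.presheaf.map _ (ℒ.carrier.presheaf.map i.op s)
  rw [← ConcreteCategory.comp_apply, ← ℒ.carrier.presheaf.map_comp]
  rfl

/-- The property that the presheaf of rings `𝔘(ℒ)` is a sheaf. -/
abbrev EnvIsSheaf : Prop :=
  Presheaf.IsSheaf (Opens.grothendieckTopology X) ℒ.envPresheaf

variable {ℒ}

/-- The universal enveloping algebroid `𝔘(ℒ)`, as a sheaf of rings on `X`. -/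
def envSheaf (h : ℒ.EnvIsSheaf) : Sheaf (Opens.grothendieckTopology X) RingCat.{u} :=
  ⟨ℒ.envPresheaf, h⟩

/-- The category of left `𝔘(ℒ)`-modules: sheaves of left modules over the
sheaf of rings `𝔘(ℒ)`. -/
abbrev EnvMod (h : ℒ.EnvIsSheaf) := SheafOfModules.{u} (envSheaf h)

/-- The homomorphism of sheaves of rings `𝒪_X → 𝔘(ℒ)`. -/
def structureToEnv (h : ℒ.EnvIsSheaf) : X.ringCatSheaf ⟶ envSheaf h where
  hom :=
    { app := fun V => RingCat.ofHom (ℒ.envOfRing V.unop)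
      naturality := fun V V' i => by
        ext f
        exact (ℒ.envGluedRestrict_envOfRing i.unop f).symm }

/-- The functor which sends a left `𝔘(ℒ)`-module to its underlying `𝒪_X`-module. -/
def envModToModules (h : ℒ.EnvIsSheaf) : EnvMod h ⥤ X.Modules :=
  SheafOfModules.restrictScalars (structureToEnv h)

/-- The sections on `V` of a left `𝔘(ℒ)`-module are a left module over `𝔘(ℒ)(V)`. -/
instance envModModule (h : ℒ.EnvIsSheaf) (N : EnvMod h) (V : X.Opens) :
    Module (ℒ.envGlued V) Γ((envModToModules h).obj N, V) :=
  inferInstanceAs (Module ((envSheaf h).obj.obj (op V)) (N.val.obj (op V)))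

lemma envMod_smul_def (h : ℒ.EnvIsSheaf) (N : EnvMod h) (V : X.Opens) (f : Γ(X, V))
    (n : Γ((envModToModules h).obj N, V)) : f • n = ℒ.envOfRing V f • n := rfl

lemma envMod_restrict_smul (h : ℒ.EnvIsSheaf) (N : EnvMod h) {U V : X.Opens} (i : U ⟶ V)
    (u : ℒ.envGlued V) (n : Γ((envModToModules h).obj N, V)) :
    ((envModToModules h).obj N).presheaf.map i.op (u • n) =
      ℒ.envGluedRestrict i.le u • ((envModToModules h).obj N).presheaf.map i.op n :=
  N.val.map_smul i.op u n

lemma envMod_map_smul (h : ℒ.EnvIsSheaf) {N N' : EnvMod h} (φ : N ⟶ N') (V : X.Opens)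
    (u : ℒ.envGlued V) (n : Γ((envModToModules h).obj N, V)) :
    ((envModToModules h).map φ).app V (u • n) = u • ((envModToModules h).map φ).app V n :=
  (φ.val.app (op V)).hom.map_smul u n

/-- The representation of `ℒ` defined by a left `𝔘(ℒ)`-module `N`: the underlying `𝒪_X`-module is
`N`, where a function acts through `𝒪_X → 𝔘(ℒ)`, and `ρ(s)(n) = s · n`. -/
def repOfEnvMod (h : ℒ.EnvIsSheaf) : EnvMod h ⥤ ℒ.Rep where
  obj N :=
    { carrier := (envModToModules h).obj N
      ρ := fun V => AddMonoidHom.mk' (fun s => DistribSMul.toAddMonoidHom _ (ℒ.envOfLie V s))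
        fun s t => by
          ext n
          change ℒ.envOfLie V (s + t) • n = ℒ.envOfLie V s • n + ℒ.envOfLie V t • n
          rw [map_add, add_smul]
      restrict := fun {U V} i s n => by
        change ((envModToModules h).obj N).presheaf.map i.op (ℒ.envOfLie V s • n) =
          ℒ.envOfLie U (ℒ.carrier.presheaf.map i.op s) •
            ((envModToModules h).obj N).presheaf.map i.op n
        rw [envMod_restrict_smul, envGluedRestrict_envOfLie]
      smul := fun V f s n => by
        change ℒ.envOfLie V (f • s) • n = f • (ℒ.envOfLie V s • n)
        rw [envMod_smul_def, envOfLie_smul, mul_smul]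
      leibniz := fun V s f n => by
        change ℒ.envOfLie V s • (f • n) = f • (ℒ.envOfLie V s • n) + ℒ.anchor V s f • n
        rw [envMod_smul_def, envMod_smul_def, envMod_smul_def, ← mul_smul, ← mul_smul, ← add_smul,
          envOfLie_mul_envOfRing]
      bracket := fun V s t n => by
        change ℒ.envOfLie V (ℒ.bracket V s t) • n =
          ℒ.envOfLie V s • (ℒ.envOfLie V t • n) - ℒ.envOfLie V t • (ℒ.envOfLie V s • n)
        rw [← mul_smul, ← mul_smul, ← sub_smul, envOfLie_bracket] }
  map φ :=
    { hom := (envModToModules h).map φ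
      comm := fun V s n => (envMod_map_smul h φ V (ℒ.envOfLie V s) n).symm }

/-- The left `𝔘(ℒ)`-modules which are coherent as `𝒪_X`-modules. -/
def envModIsCoherent (h : ℒ.EnvIsSheaf) : ObjectProperty (EnvMod h) :=
  fun N => SheafOfModules.IsFinitePresentation (R := X.ringCatSheaf) ((envModToModules h).obj N)

/-- The functor `repOfEnvMod`, restricted to coherent modules. -/
def coherentRepOfEnvMod (h : ℒ.EnvIsSheaf) :
    (envModIsCoherent h).FullSubcategory ⥤ (Rep.isCoherent ℒ).FullSubcategory :=
  (Rep.isCoherent ℒ).lift ((envModIsCoherent h).ι ⋙ repOfEnvMod h) fun N => N.property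

end Enveloping

end LieAlgebroid

end

noncomputable section

namespace LieRinehart

namespace Env

section UniversalProperty

variable {k : Type u} {A : Type v} {L : Type w} [CommRing k] [CommRing A] [Algebra k A]
  [LieRing L] [Module A L] [LieRingModule L A] [LieAlgebra k L]
  [LieRinehartRing A L] [LieRinehartAlgebra k A L]

lemma ofRing_algebraMap (c : k) :
    ofRing k A L (algebraMap k A c) = algebraMap k (Env k A L) c := by
  have h : (⟨algebraMap k A c, 0⟩ : Ext A L) = c • ⟨1, 0⟩ := by
    ext <;> simp [Algebra.algebraMap_eq_smul_one]
  change ι k A L _ = _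
  rw [h, map_smul, ι_one, Algebra.algebraMap_eq_smul_one]

lemma ι_eq (u : Ext A L) : ι k A L u = ofRing k A L u.fst + ofLie k A L u.snd := by
  change _ = ι k A L _ + ι k A L _
  rw [← map_add]
  congr 1
  ext <;> simp

attribute [local instance 100] LieRing.ofAssociativeRing in
/-- The universal property of the enveloping algebra of a Lie-Rinehart algebra. -/
lemma exists_lift {B : Type*} [Ring B] [Algebra k B] (ψ : A →ₐ[k] B) (φ : L →+ B)
    (h_smul : ∀ f s, φ (f • s) = ψ f * φ s)
    (h_comm : ∀ s f, φ s * ψ f = ψ f * φ s + ψ ⁅s, f⁆)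
    (h_lie : ∀ s t, φ ⁅s, t⁆ = φ s * φ t - φ t * φ s) :
    ∃ Φ : Env k A L →ₐ[k] B,
      (∀ f, Φ (ofRing k A L f) = ψ f) ∧ ∀ s, Φ (ofLie k A L s) = φ s := by
  let θ : Ext A L →ₗ⁅k⁆ B :=
    { toFun := fun u => ψ u.fst + φ u.snd
      map_add' := fun u v => by simp only [Ext.add_fst, Ext.add_snd, map_add]; abel
      map_smul' := fun c u => by
        have h : φ (c • u.snd) = c • φ u.snd := by
          rw [← algebraMap_smul A c u.snd, h_smul, AlgHom.commutes, Algebra.smul_def]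
        simp [h]
      map_lie' := fun {u v} => by
        have h : ψ v.fst * ψ u.fst = ψ u.fst * ψ v.fst := by rw [← map_mul, mul_comm, map_mul]
        rw [LieRing.of_associative_ring_bracket]
        simp only [Ext.lie_fst, Ext.lie_snd, map_sub ψ, h_lie, mul_add, add_mul, h_comm, h]
        abel }
  have hθ (u : Ext A L) : θ u = ψ u.fst + φ u.snd := rfl
  let Φ : Env k A L →ₐ[k] B := RingQuot.liftAlgHom k ⟨UniversalEnvelopingAlgebra.lift k θ, by
    rintro _ _ (⟨f, u⟩ | _)
    · simp only [map_mul, UniversalEnvelopingAlgebra.lift_ι_apply, hθ, Ext.smul_fst, Ext.smul_snd,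
        h_smul, map_zero, add_zero, mul_add]
    · simp only [map_one, UniversalEnvelopingAlgebra.lift_ι_apply, hθ, map_zero, add_zero]⟩
  have hΦ (u : Ext A L) : Φ (ι k A L u) = ψ u.fst + φ u.snd :=
    (RingQuot.liftAlgHom_mkAlgHom_apply _ _ _ _).trans
      (UniversalEnvelopingAlgebra.lift_ι_apply k θ u)
  exact ⟨Φ, fun f => (hΦ ⟨f, 0⟩).trans (by simp), fun s => (hΦ ⟨0, s⟩).trans (by simp)⟩

attribute [local instance 100] LieRing.ofAssociativeRing in
/-- The enveloping algebra is generated by the ring and the Lie algebra. -/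
@[elab_as_elim]
lemma induction {P : Env k A L → Prop} (h_ring : ∀ f, P (ofRing k A L f))
    (h_lie : ∀ s, P (ofLie k A L s)) (h_add : ∀ x y, P x → P y → P (x + y))
    (h_mul : ∀ x y, P x → P y → P (x * y)) (x : Env k A L) : P x := by
  let B : Subalgebra k (Env k A L) :=
    { carrier := {x | P x}
      add_mem' := h_add _ _
      mul_mem' := h_mul _ _
      algebraMap_mem' := fun c => by
        change P _
        rw [← ofRing_algebraMap]
        exact h_ring _ }
  obtain ⟨Φ, hΦ, hΦ'⟩ := exists_lift (k := k) (A := A) (L := L) (B := B)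
    (AlgHom.mk ((ofRing k A L).codRestrict B h_ring)
      fun c => Subtype.ext (ofRing_algebraMap c))
    ((ofLie k A L).codRestrict B h_lie)
    (fun f s => Subtype.ext (ofLie_smul k A L f s))
    (fun s f => Subtype.ext (ofLie_mul_ofRing k A L s f))
    (fun s t => Subtype.ext (ofLie_lie k A L s t))
  have h : B.val.comp Φ = AlgHom.id k _ := algHom_ext fun u => by
    rw [ι_eq, map_add, map_add, AlgHom.comp_apply, AlgHom.comp_apply, hΦ, hΦ']
    rfl
  have := congrArg (fun χ => χ x) h
  change (Φ x : Env k A L) = x at this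
  rw [← this]
  exact (Φ x).2

end UniversalProperty

section Localization

variable {k : Type u} {A : Type v} {L : Type w} [CommRing k] [CommRing A] [Algebra k A]
  [LieRing L] [Module A L] [LieRingModule L A] [LieAlgebra k L]
  [LieRinehartRing A L] [LieRinehartAlgebra k A L]
  {A' : Type v} {L' : Type w} [CommRing A'] [Algebra k A'] [LieRing L'] [Module A' L']
  [LieRingModule L' A'] [LieAlgebra k L'] [LieRinehartRing A' L'] [LieRinehartAlgebra k A' L']
  (S : Submonoid A) [Algebra A A'] [Module A L'] [IsScalarTower A A' L'] [IsLocalization S A']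
  {σ : A →ₐ[k] A'} (F : LieRinehartAlgebra.Hom σ L L') (hσ : ∀ f, σ f = algebraMap A A' f)
  (FA : L →ₗ[A] L') (hF : ∀ s, F s = FA s) [IsLocalizedModule S FA]

include S hσ hF in
/-- A homomorphism from the enveloping algebra which inverts `S` extends to the enveloping
algebra of the localization. -/
lemma exists_extend {B : Type*} [Ring B] [Algebra k B] (Φ : Env k A L →ₐ[k] B)
    (hS : ∀ t ∈ S, IsUnit (Φ (ofRing k A L t))) :
    ∃ Φ' : Env k A' L' →ₐ[k] B, ∀ x, Φ' (map F x) = Φ x := by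
  let _ : Module A B := Module.compHom B (Φ.toRingHom.comp (ofRing k A L))
  have smul_B (f : A) (b : B) : f • b = Φ (ofRing k A L f) * b := rfl
  have hu (t : S) : IsUnit (algebraMap A (Module.End A B) t) := by
    rw [Module.End.isUnit_iff]
    obtain ⟨c, hc⟩ := hS t t.2
    have : ⇑(algebraMap A (Module.End A B) t) = fun b : B => (c : B) * b := by
      ext b
      rw [hc]
      rfl
    rw [this]
    exact c.mulLeft_bijective
  have cancel (t : S) {x y : B} (h : Φ (ofRing k A L t) * x = Φ (ofRing k A L t) * y) : x = y :=
    (hS t t.2).mul_right_injective h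
  let α : A →ₗ[A] B :=
    { toFun := fun f => Φ (ofRing k A L f)
      map_add' := fun _ _ => by simp
      map_smul' := fun f g => by simp [smul_B] }
  let β : L →ₗ[A] B :=
    { toFun := fun s => Φ (ofLie k A L s)
      map_add' := fun _ _ => by simp
      map_smul' := fun f g => by simp [smul_B, ofLie_smul] }
  let ψ : A' →ₗ[A] B := IsLocalizedModule.lift S (Algebra.linearMap A A') α hu
  let φ : L' →ₗ[A] B := IsLocalizedModule.lift S FA β hu
  have ψσ (f : A) : ψ (σ f) = Φ (ofRing k A L f) := by
    rw [hσ]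
    exact IsLocalizedModule.lift_apply S (Algebra.linearMap A A') α hu f
  have φF (s : L) : φ (F s) = Φ (ofLie k A L s) := by
    rw [hF]
    exact IsLocalizedModule.lift_apply S FA β hu s
  have ψ_mul' (f : A) (g : A') : ψ (σ f * g) = Φ (ofRing k A L f) * ψ g := by
    rw [hσ, ← Algebra.smul_def, map_smul, smul_B]
  have φ_smul' (f : A) (s : L') : φ (σ f • s) = Φ (ofRing k A L f) * φ s := by
    rw [hσ, algebraMap_smul, map_smul, smul_B]
  have denA (g : A') : ∃ (t : S) (f : A), σ t * g = σ f := by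
    obtain ⟨⟨f, t⟩, h⟩ := IsLocalization.surj S g
    exact ⟨t, f, by rw [hσ, hσ, mul_comm]; exact h⟩
  have denL (s' : L') : ∃ (t : S) (s : L), σ (t : A) • s' = F s := by
    obtain ⟨⟨s, t⟩, h⟩ := IsLocalizedModule.surj S FA s'
    exact ⟨t, s, by rw [hσ, algebraMap_smul, hF]; exact h⟩
  have ψ_mul (f g : A') : ψ (f * g) = ψ f * ψ g := by
    obtain ⟨t, f₀, h⟩ := denA f
    apply cancel t
    rw [← ψ_mul', ← mul_assoc, ← mul_assoc, ← ψ_mul', h, ψ_mul', ψσ]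
  have φ_smul (f : A') (s : L') : φ (f • s) = ψ f * φ s := by
    obtain ⟨t, f₀, h⟩ := denA f
    apply cancel t
    rw [← φ_smul', ← mul_smul, ← mul_assoc, ← ψ_mul', h, φ_smul', ψσ]
  have comm₀ (s : L) (f : A) : Φ (ofLie k A L s) * Φ (ofRing k A L f) =
      Φ (ofRing k A L f) * Φ (ofLie k A L s) + Φ (ofRing k A L ⁅s, f⁆) := by
    rw [← map_mul, ofLie_mul_ofRing, map_add, map_mul]
  have comm₁ (s : L) (g : A') : φ (F s) * ψ g = ψ g * φ (F s) + ψ ⁅F s, g⁆ := by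
    obtain ⟨t, f, h⟩ := denA g
    apply cancel t
    have h₁ : ψ ⁅F s, σ t * g⁆ = Φ (ofRing k A L ⁅s, f⁆) := by
      rw [h, ← F.apply_lie, ψσ]
    rw [LieRinehartRing.leibniz_mul_right, map_add, smul_eq_mul, ψ_mul', ← F.apply_lie,
      ψ_mul'] at h₁
    have h₂ := comm₀ s t
    have h₃ := comm₀ s f
    rw [← ψσ f, ← h, ψ_mul'] at h₃
    rw [φF, mul_add, eq_sub_of_add_eq h₁, ← mul_assoc, ← mul_assoc]
    rw [← mul_assoc, h₂, add_mul] at h₃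
    rw [eq_sub_of_add_eq h₃]
    abel
  have comm (s : L') (g : A') : φ s * ψ g = ψ g * φ s + ψ ⁅s, g⁆ := by
    obtain ⟨t, s₀, h⟩ := denL s
    apply cancel t
    rw [← mul_assoc, ← φ_smul', h, comm₁, mul_add, ← ψ_mul', ← LieRinehartRing.lie_smul_eq_mul,
      ← h, φ_smul', ← ψσ, ← mul_assoc, ← mul_assoc, ← ψ_mul, ← ψ_mul, mul_comm]
  have lie₁ (s : L) (r : L') : φ ⁅F s, r⁆ = φ (F s) * φ r - φ r * φ (F s) := by
    obtain ⟨t, r₀, h⟩ := denL r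
    apply cancel t
    have h₁ : φ ⁅F s, σ (t : A) • r⁆ = φ (F s) * φ (F r₀) - φ (F r₀) * φ (F s) := by
      rw [h, ← LieHom.map_lie, φF, φF, φF, ofLie_lie, map_sub, map_mul, map_mul]
    rw [LieRinehartRing.leibniz_smul_right, map_add, φ_smul', φ_smul, ← h, φ_smul', ← ψσ,
      ← mul_assoc, comm, add_mul] at h₁
    rw [← ψσ, eq_sub_of_add_eq h₁]
    noncomm_ring
  have lie (s r : L') : φ ⁅s, r⁆ = φ s * φ r - φ r * φ s := by
    obtain ⟨t, s₀, h⟩ := denL s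
    apply cancel t
    have h₁ : φ ⁅r, σ (t : A) • s⁆ = φ r * φ (F s₀) - φ (F s₀) * φ r := by
      rw [h, ← lie_skew, map_neg, lie₁]
      abel
    rw [LieRinehartRing.leibniz_smul_right, map_add, φ_smul', φ_smul, ← h, φ_smul', ← ψσ,
      ← mul_assoc, comm, add_mul] at h₁
    rw [← lie_skew, map_neg, mul_neg, ← ψσ, eq_sub_of_add_eq h₁]
    noncomm_ring
  let ψ' : A' →ₐ[k] B := AlgHom.ofLinearMap
    { toFun := ψ
      map_add' := map_add ψ
      map_smul' := fun c g => by
        have h : c • g = σ (algebraMap k A c) * g := by rw [AlgHom.commutes, Algebra.smul_def]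
        rw [h, ψ_mul', ofRing_algebraMap, AlgHom.commutes, RingHom.id_apply, Algebra.smul_def] }
    (by
      change ψ 1 = 1
      rw [← map_one σ, ψσ, map_one, map_one]) ψ_mul
  obtain ⟨Φ', h, h'⟩ := exists_lift (k := k) ψ' φ.toAddMonoidHom φ_smul comm lie
  refine ⟨Φ', fun x => ?_⟩
  have : Φ'.comp (map F) = Φ := algHom_ext fun u => by
    rw [ι_eq, map_add, map_add, AlgHom.comp_apply, AlgHom.comp_apply, map_ofRing, map_ofLie, h, h']
    exact congrArg₂ _ (ψσ _) (φF _)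
  exact congrArg (fun χ => χ x) this

end Localization

end Env

end LieRinehart

namespace LocalizedModule

variable {A M : Type*} [CommRing A] [AddCommGroup M] [Module A M] (S : Submonoid A)

/-- An additive operator on a module which satisfies the Leibniz rule extends to the
localizations of the module, by the quotient rule. -/
lemma exists_leibniz_extension {δ : A → A} (hδ : ∀ a b, δ (a * b) = a * δ b + b * δ a)
    {d : M →+ M} (hd : ∀ (a : A) (m : M), d (a • m) = a • d m + δ a • m) :
    ∃ d' : LocalizedModule S M →+ LocalizedModule S M,
      (∀ m, d' (mk m 1) = mk (d m) 1) ∧ ∀ (a : A) x, d' (a • x) = a • d' x + δ a • x := by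
  have δ_one : δ 1 = 0 := by
    have := hδ 1 1
    rw [one_mul, one_mul] at this
    exact left_eq_add.mp this
  let q : M × S → LocalizedModule S M := fun p =>
    mk ((p.2 : A) • d p.1 - δ p.2 • p.1) (p.2 * p.2)
  have hq (p p' : M × S) (h : p ≈ p') : q p = q p' := by
    obtain ⟨u, hu⟩ := h
    obtain ⟨m, t⟩ := p
    obtain ⟨m', t'⟩ := p'
    simp only [Submonoid.smul_def] at hu
    have hu' := congrArg d hu
    simp only [hd, smul_add] at hu'
    refine mk_eq.mpr ⟨u * u, ?_⟩
    simp only [Submonoid.smul_def, Submonoid.coe_mul]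
    linear_combination (norm := module) ((u : A) * t * t') • hu' - ((t : A) * t' * δ u) • hu -
      ((u : A) * (t' * δ t + t * δ t')) • hu
  let d₀ : LocalizedModule S M → LocalizedModule S M := fun x => x.liftOn q hq
  have d₀_mk (m : M) (t : S) : d₀ (mk m t) = mk ((t : A) • d m - δ t • m) (t * t) :=
    liftOn_mk hq m t
  refine ⟨AddMonoidHom.mk' d₀ fun x y => ?_, fun m => ?_, fun a x => ?_⟩
  · induction x, y using induction_on₂ with | _ m m' t t'
    rw [mk_add_mk, d₀_mk, d₀_mk, d₀_mk, mk_add_mk]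
    simp only [Submonoid.smul_def, Submonoid.coe_mul, map_add, hd, hδ]
    refine mk_eq.mpr ⟨1, ?_⟩
    simp only [Submonoid.smul_def, Submonoid.coe_mul, one_smul]
    module
  · change d₀ (mk m 1) = _
    rw [d₀_mk]
    simp [δ_one]
  · change d₀ (a • x) = a • d₀ x + δ a • x
    induction x using induction_on with | _ m t
    rw [smul'_mk, smul'_mk, d₀_mk, d₀_mk, smul'_mk, mk_add_mk, hd]
    refine mk_eq.mpr ⟨1, ?_⟩
    simp only [Submonoid.smul_def, Submonoid.coe_mul, one_smul]
    module

variable {S} in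
lemma eq_zero_of_linear {e : LocalizedModule S M →+ LocalizedModule S M}
    (he : ∀ (a : A) x, e (a • x) = a • e x) (h : ∀ m, e (mk m 1) = 0) : e = 0 := by
  ext x
  induction x using induction_on with | _ m t
  refine eq_zero_of_smul_eq_zero (t : A) t.2 _ ?_
  rw [← he, smul'_mk, ← Submonoid.smul_def, mk_cancel, h]

end LocalizedModule

namespace LieRinehart

namespace Env

variable {k : Type u} {A : Type v} {L : Type w} [CommRing k] [CommRing A] [Algebra k A]
  [LieRing L] [Module A L] [LieRingModule L A] [LieAlgebra k L]
  [LieRinehartRing A L] [LieRinehartAlgebra k A L] (S : Submonoid A)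

/-- A representation of a Lie-Rinehart algebra extends to the localizations of the
underlying module. -/
lemma exists_localized_action {M : Type*} [AddCommGroup M] [Module k M] [Module A M]
    [IsScalarTower k A M] (ρ : L →+ M →+ M) (h_smul : ∀ (f : A) s m, ρ (f • s) m = f • ρ s m)
    (h_leibniz : ∀ s (f : A) m, ρ s (f • m) = f • ρ s m + ⁅s, f⁆ • m)
    (h_lie : ∀ s t m, ρ ⁅s, t⁆ m = ρ s (ρ t m) - ρ t (ρ s m)) :
    ∃ Φ : Env k A L →ₐ[k] Module.End k (LocalizedModule S M),
      (∀ f x, Φ (ofRing k A L f) x = f • x) ∧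
      ∀ s m, Φ (ofLie k A L s) (LocalizedModule.mk m 1) = LocalizedModule.mk (ρ s m) 1 := by
  have (s : L) := LocalizedModule.exists_leibniz_extension S (δ := fun f => ⁅s, f⁆)
    (fun a b => by simp [mul_comm]) (h_leibniz s)
  choose d d_mk d_smul using this
  have smul_eq (c : k) (x : LocalizedModule S M) : c • x = algebraMap k A c • x :=
    (algebraMap_smul A c x).symm
  have lie_algebraMap (s : L) (c : k) : ⁅s, algebraMap k A c⁆ = 0 := by
    have h : ⁅s, (1 : A)⁆ = 0 := by
      have := LieRinehartRing.leibniz_mul_right s (1 : A) 1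
      simp only [mul_one, one_smul] at this
      exact left_eq_add.mp this
    rw [Algebra.algebraMap_eq_smul_one]
    exact (LieModule.lie_smul (R := k) c s (1 : A)).trans (by rw [h, smul_zero])
  let D (s : L) : Module.End k (LocalizedModule S M) :=
    { toFun := d s
      map_add' := map_add (d s)
      map_smul' := fun c x => by
        rw [smul_eq, d_smul, lie_algebraMap, zero_smul, add_zero, RingHom.id_apply, smul_eq] }
  have D_apply (s : L) (x) : D s x = d s x := rfl
  have ext_aux {P Q : Module.End k (LocalizedModule S M)}
      (h : ∀ (f : A) x, P (f • x) - Q (f • x) = f • (P x - Q x))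
      (h' : ∀ m, P (LocalizedModule.mk m 1) = Q (LocalizedModule.mk m 1)) : P = Q := by
    ext x
    have := LocalizedModule.eq_zero_of_linear (e := (P - Q).toAddMonoidHom) h fun m => sub_eq_zero.mpr (h' m)
    exact sub_eq_zero.mp (congrArg (fun e => e x) this)
  have D_add (s t : L) : D (s + t) = D s + D t := by
    refine ext_aux (fun f x => ?_) fun m => ?_
    · simp only [LinearMap.add_apply, D_apply, d_smul, add_lie]
      module
    · simp [D_apply, d_mk]
  obtain ⟨Φ, hΦ, hΦ'⟩ := exists_lift (k := k) (A := A) (L := L)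
    (Algebra.lsmul k (A := A) k (LocalizedModule S M)) (AddMonoidHom.mk' D D_add)
    (fun f s => by
      refine ext_aux (fun g x => ?_) fun m => ?_
      · simp only [AddMonoidHom.mk'_apply, Module.End.mul_apply, Algebra.lsmul_coe, D_apply,
          d_smul, LieRinehartRing.lie_smul_eq_mul]
        module
      · simp [D_apply, d_mk, h_smul, LocalizedModule.smul'_mk])
    (fun s f => by
      ext x
      simp [D_apply, d_smul])
    (fun s t => by
      refine ext_aux (fun g x => ?_) fun m => ?_
      · simp only [AddMonoidHom.mk'_apply, Module.End.mul_apply, LinearMap.sub_apply, D_apply,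
          d_smul, map_add, lie_lie]
        module
      · simp only [AddMonoidHom.mk'_apply, Module.End.mul_apply, LinearMap.sub_apply, D_apply,
          d_mk, h_lie]
        simp [sub_eq_add_neg])
  exact ⟨Φ, fun f x => by rw [hΦ]; rfl, fun s m => by rw [hΦ']; exact d_mk s m⟩

variable {A' : Type v} {L' : Type w} [CommRing A'] [Algebra k A'] [LieRing L'] [Module A' L']
  [LieRingModule L' A'] [LieAlgebra k L'] [LieRinehartRing A' L'] [LieRinehartAlgebra k A' L']
  [Algebra A A'] [Module A L'] [IsScalarTower A A' L'] [IsLocalization S A']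
  {σ : A →ₐ[k] A'} (F : LieRinehartAlgebra.Hom σ L L') (hσ : ∀ f, σ f = algebraMap A A' f)
  (FA : L →ₗ[A] L') (hF : ∀ s, F s = FA s) [IsLocalizedModule S FA]

include S hσ hF in
/-- The kernel of the map of enveloping algebras induced by a localization. -/
lemma exists_mul_eq_zero_of_map_eq_zero {x : Env k A L} (hx : map F x = 0) :
    ∃ t ∈ S, ofRing k A L t * x = 0 := by
  let _ : Module A (Env k A L) := Module.compHom _ (ofRing k A L)
  have smul_E (f : A) (y : Env k A L) : f • y = ofRing k A L f * y := rfl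
  have : IsScalarTower k A (Env k A L) := ⟨fun c f y => by
    rw [smul_E, smul_E, Algebra.smul_def, map_mul, ofRing_algebraMap, Algebra.smul_def, mul_assoc]⟩
  obtain ⟨Φ, hΦ, hΦ'⟩ := exists_localized_action S (k := k) (M := Env k A L)
    (AddMonoidHom.mul.comp (ofLie k A L)) (fun f s m => by
      simp [smul_E, ofLie_smul, mul_assoc]) (fun s f m => by
      simp [smul_E, ← mul_assoc, ofLie_mul_ofRing, add_mul]) (fun s t m => by
      simp [ofLie_lie, sub_mul, mul_assoc])
  have hΦ_mk (x y : Env k A L) : Φ x (LocalizedModule.mk y 1) = LocalizedModule.mk (x * y) 1 := by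
    induction x using induction generalizing y with
    | h_ring f => rw [hΦ, LocalizedModule.smul'_mk, smul_E]
    | h_lie s => exact hΦ' s y
    | h_add x x' h h' => rw [map_add, LinearMap.add_apply, h, h', add_mul]; simp
    | h_mul x x' h h' => rw [map_mul, Module.End.mul_apply, h', h, mul_assoc]
  obtain ⟨Φ', h⟩ := exists_extend S F hσ FA hF Φ fun t ht => by
    rw [Module.End.isUnit_iff]
    have : ⇑(Φ (ofRing k A L t)) = algebraMap A (Module.End A
        (LocalizedModule S (Env k A L))) t := funext fun x => hΦ t x
    rw [this, ← Module.End.isUnit_iff]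
    exact IsLocalizedModule.map_units (LocalizedModule.mkLinearMap S (Env k A L)) ⟨t, ht⟩
  have h₁ := hΦ_mk x 1
  rw [← h, hx, map_zero, LinearMap.zero_apply, mul_one, ← LocalizedModule.zero_mk 1,
    LocalizedModule.mk_eq] at h₁
  obtain ⟨t, ht⟩ := h₁
  refine ⟨t, t.2, ?_⟩
  simpa [Submonoid.smul_def, smul_E] using ht.symm

lemma pow_dvd_lie_pow (s : L) (f : A) (n : ℕ) : f ^ n ∣ ⁅s, f ^ (n + 1)⁆ := by
  induction n with
  | zero => simp
  | succ n ih =>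
    rw [pow_succ _ (n + 1), LieRinehartRing.leibniz_mul_right, smul_eq_mul]
    refine dvd_add (Dvd.intro _ rfl) ?_
    exact (pow_succ f n).symm ▸ mul_dvd_mul_right ih f

include hσ hF in
/-- The image of the map of enveloping algebras induced by a localization. -/
lemma exists_mul_eq_map (f : A) [IsLocalization (Submonoid.powers f) A']
    [IsLocalizedModule (Submonoid.powers f) FA] (y : Env k A' L') :
    ∃ (n : ℕ) (x : Env k A L), ofRing k A' L' (σ f) ^ n * y = map F x := by
  suffices h : ∀ z : Env k A' L', (∃ (n : ℕ) (x : Env k A L), ofRing k A' L' (σ f) ^ n * z = map F x) →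
      ∃ (n : ℕ) (x : Env k A L), ofRing k A' L' (σ f) ^ n * (y * z) = map F x by
    simpa using h 1 ⟨0, 1, by simp⟩
  induction y using induction with
  | h_ring g =>
    rintro z ⟨n, x, hx⟩
    obtain ⟨⟨g₀, t⟩, h⟩ := IsLocalization.surj (Submonoid.powers f) g
    obtain ⟨m, hm⟩ := t.2
    refine ⟨n + m, ofRing k A L g₀ * x, ?_⟩
    have h' : ofRing k A' L' (σ f) ^ m * ofRing k A' L' g = map F (ofRing k A L g₀) := by
      rw [map_ofRing, hσ, hσ, ← map_pow, ← map_mul, ← map_pow, mul_comm]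
      exact congrArg _ ((congrArg (g * algebraMap A A' ·) hm).trans h)
    have hc : Commute (ofRing k A' L' (σ f) ^ n) (ofRing k A' L' g) :=
      ((Commute.all (σ f) g).map (ofRing k A' L')).pow_left n
    rw [map_mul, ← h', ← hx, add_comm, pow_add, mul_assoc, mul_assoc, ← mul_assoc _ _ z,
      hc.eq, mul_assoc]
  | h_lie s =>
    rintro z ⟨n, x, hx⟩
    obtain ⟨⟨s₀, t⟩, h⟩ := IsLocalizedModule.surj (Submonoid.powers f) FA s
    obtain ⟨m, hm⟩ := t.2
    have h' : ofRing k A' L' (σ f) ^ m * ofLie k A' L' s = map F (ofLie k A L s₀) := by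
      rw [map_ofLie, hF, ← h, ← map_pow, ← ofLie_smul, ← map_pow, hσ, algebraMap_smul]
      exact congrArg (fun r : A => ofLie k A' L' (r • s)) hm
    have key := ofLie_mul_ofRing k A' L' (F s₀) (σ (f ^ (n + 1)))
    obtain ⟨c, hc⟩ := pow_dvd_lie_pow s₀ f n
    refine ⟨m + (n + 1), ofLie k A L s₀ * ofRing k A L f * x - ofRing k A L c * x, ?_⟩
    rw [← F.apply_lie, hc, map_mul, map_mul, map_pow, map_pow, map_pow, map_pow] at key
    have hz : ofRing k A' L' (σ f) ^ (m + (n + 1)) * (ofLie k A' L' s * z) =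
        ofRing k A' L' (σ f) ^ (n + 1) * ofLie k A' L' (F s₀) * z := by
      rw [← map_ofLie, ← h', add_comm, pow_add, mul_assoc, mul_assoc, mul_assoc]
    have hc' : ofRing k A' L' (σ f) ^ n * ofRing k A' L' (σ c) * z =
        ofRing k A' L' (σ c) * (ofRing k A' L' (σ f) ^ n * z) := by
      rw [← mul_assoc, (((Commute.all (σ f) (σ c)).map (ofRing k A' L')).pow_left n).eq]
    rw [hz, ← sub_eq_of_eq_add key, sub_mul, hc', hx, map_sub, map_mul, map_mul, map_mul, ← hx,
      map_ofLie, map_ofRing, map_ofRing, pow_succ', mul_assoc, mul_assoc, mul_assoc]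
  | h_add y y' h h' =>
    intro z hz
    obtain ⟨n, x, hx⟩ := h z hz
    obtain ⟨n', x', hx'⟩ := h' z hz
    refine ⟨n + n', ofRing k A L f ^ n' * x + ofRing k A L f ^ n * x', ?_⟩
    rw [add_mul, mul_add, map_add, map_mul, map_mul, ← hx, ← hx', map_pow, map_pow, map_ofRing,
      ← mul_assoc _ _ (y * z), ← mul_assoc _ _ (y' * z), ← pow_add, ← pow_add, add_comm n' n]
  | h_mul y y' h h' =>
    intro z hz
    rw [mul_assoc]
    exact h _ (h' _ hz)

end Env

end LieRinehart

section Gluing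

variable {A R : Type*} [CommRing A] [Ring R] (ρ : A →+* R)

/-- An element of an algebra which is killed by powers of functions generating the unit ideal
vanishes. -/
lemma eq_zero_of_pow_mul_eq_zero {s : Set A} (hs : Ideal.span s = ⊤) {x : R}
    (h : ∀ f ∈ s, ∃ n : ℕ, ρ f ^ n * x = 0) : x = 0 := by
  let I : Ideal A :=
    { carrier := {a | ρ a * x = 0}
      add_mem' := fun {a b} ha hb => by
        change ρ (a + b) * x = 0
        rw [map_add, add_mul, show ρ a * x = 0 from ha, show ρ b * x = 0 from hb, add_zero]
      zero_mem' := by simp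
      smul_mem' := fun c a ha => by
        change ρ (c * a) * x = 0
        rw [map_mul, mul_assoc, show ρ a * x = 0 from ha, mul_zero] }
  have hI : I = ⊤ := by
    by_contra hI
    obtain ⟨m, hm, hIm⟩ := Ideal.exists_le_maximal I hI
    refine hm.ne_top (top_le_iff.mp (hs ▸ Ideal.span_le.mpr fun f hf => ?_))
    obtain ⟨n, hn⟩ := h f hf
    exact hm.isPrime.mem_of_pow_mem n (hIm (by simpa [I] using hn))
  have : (1 : A) ∈ I := hI ▸ Submodule.mem_top
  simpa [I] using this

/-- Gluing for algebras over a commutative ring with respect to a covering by principal open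
subsets. -/
lemma exists_glue_of_span_eq_top {ι : Type*} [Finite ι] {f : ι → A}
    (hf : Ideal.span (Set.range f) = ⊤) {N : ι → Type*} [∀ i, Ring (N i)]
    {P : ι → ι → Type*} [∀ i j, Ring (P i j)] (g : ∀ i, R →+* N i)
    (p : ∀ i j, N i →+* P i j) (q : ∀ i j, N j →+* P i j)
    (hpq : ∀ i j x, p i j (g i x) = q i j (g j x))
    (h_unit : ∀ i, IsUnit (g i (ρ (f i))))
    (h_surj : ∀ i y, ∃ (n : ℕ) (x : R), g i (ρ (f i)) ^ n * y = g i x)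
    (h_inj : ∀ i j x, p i j (g i x) = 0 → ∃ n : ℕ, ρ (f i * f j) ^ n * x = 0)
    (e : ∀ i, N i) (he : ∀ i j, p i j (e i) = q i j (e j)) :
    ∃ x, ∀ i, g i x = e i := by
  cases nonempty_fintype ι
  choose n₀ x₀ hx₀ using fun i => h_surj i (e i)
  obtain ⟨n, x₁, hx₁⟩ : ∃ (n : ℕ) (x₁ : ι → R), ∀ i, g i (ρ (f i ^ n)) * e i = g i (x₁ i) := by
    refine ⟨∑ i, n₀ i, fun i => ρ (f i) ^ (∑ i, n₀ i - n₀ i) * x₀ i, fun i => ?_⟩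
    have : n₀ i ≤ ∑ i, n₀ i :=
      Finset.single_le_sum (fun _ _ => Nat.zero_le _) (Finset.mem_univ i)
    rw [map_mul, ← hx₀, map_pow (g i), ← mul_assoc, ← pow_add, Nat.sub_add_cancel this, map_pow,
      map_pow]
  have h₁ (i j : ι) : p i j (g i (ρ (f j ^ n) * x₁ i - ρ (f i ^ n) * x₁ j)) = 0 := by
    rw [map_sub, map_sub, sub_eq_zero, hpq i j (ρ (f i ^ n) * x₁ j), map_mul (g i), ← hx₁,
      map_mul (g j), ← hx₁, ← mul_assoc, ← mul_assoc, ← map_mul (g i), ← map_mul ρ,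
      ← map_mul (g j), ← map_mul ρ, map_mul (p i j), map_mul (q i j), he, hpq, mul_comm]
  choose m₀ hm₀ using fun i j => h_inj i j _ (h₁ i j)
  obtain ⟨m, hm⟩ : ∃ m, ∀ i j, m₀ i j ≤ m :=
    ⟨∑ i, ∑ j, m₀ i j, fun i j =>
      (Finset.single_le_sum (f := fun j => m₀ i j) (fun _ _ => Nat.zero_le _)
        (Finset.mem_univ j)).trans
      (Finset.single_le_sum (f := fun i => ∑ j, m₀ i j) (fun _ _ => Nat.zero_le _)
        (Finset.mem_univ i))⟩
  obtain ⟨x₂, hx₂, h₂⟩ : ∃ x₂ : ι → R, (∀ i, g i (ρ (f i ^ (m + n))) * e i = g i (x₂ i)) ∧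
      ∀ i j, ρ (f j ^ (m + n)) * x₂ i = ρ (f i ^ (m + n)) * x₂ j := by
    refine ⟨fun i => ρ (f i ^ m) * x₁ i, fun i => ?_, fun i j => ?_⟩
    · rw [pow_add, map_mul, map_mul, mul_assoc, hx₁, map_mul]
    · have h : ρ ((f i * f j) ^ m) * (ρ (f j ^ n) * x₁ i - ρ (f i ^ n) * x₁ j) = 0 := by
        rw [← Nat.sub_add_cancel (hm i j), pow_add, map_mul, mul_assoc, map_pow ρ _ (m₀ i j),
          hm₀, mul_zero]
      rw [mul_sub, sub_eq_zero, ← mul_assoc, ← mul_assoc, ← map_mul, ← map_mul] at h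
      rw [← mul_assoc, ← mul_assoc, ← map_mul, ← map_mul]
      convert h using 3 <;> ring
  have hspan : Ideal.span (Set.range fun i => f i ^ (m + n)) = ⊤ := by
    have := Ideal.span_pow_eq_top _ hf (m + n)
    rwa [← Set.range_comp] at this
  obtain ⟨a, ha⟩ := Ideal.mem_span_range_iff_exists_fun.mp
    (hspan ▸ Submodule.mem_top : (1 : A) ∈ Ideal.span (Set.range fun i => f i ^ (m + n)))
  refine ⟨∑ i, ρ (a i) * x₂ i, fun j => ?_⟩
  have h₃ : ρ (f j ^ (m + n)) * ∑ i, ρ (a i) * x₂ i = x₂ j := by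
    rw [Finset.mul_sum]
    calc _ = ∑ i, ρ (a i * f i ^ (m + n)) * x₂ j := by
          refine Finset.sum_congr rfl fun i _ => ?_
          rw [map_mul, mul_assoc, ← h₂, ← mul_assoc, ← mul_assoc, ← map_mul, ← map_mul, mul_comm]
      _ = x₂ j := by rw [← Finset.sum_mul, ← map_sum, ha, map_one, one_mul]
  refine ((h_unit j).pow (m + n)).mul_right_injective ?_
  change g j (ρ (f j)) ^ (m + n) * g j _ = g j (ρ (f j)) ^ (m + n) * e j
  rw [← map_pow (g j), ← map_pow ρ, hx₂, ← map_mul, h₃]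

end Gluing

namespace AlgebraicGeometry

variable {X : Scheme.{u}}

lemma Scheme.presheaf_map_map (X : Scheme.{u}) {U V W : X.Opens} (i : U ⟶ V) (j : V ⟶ W)
    (l : U ⟶ W) (f : Γ(X, W)) :
    X.presheaf.map i.op (X.presheaf.map j.op f) = X.presheaf.map l.op f := by
  rw [← CommRingCat.comp_apply, ← X.presheaf.map_comp]
  rfl

lemma Scheme.presheaf_map_id (X : Scheme.{u}) {U : X.Opens} (f : Γ(X, U)) :
    X.presheaf.map (𝟙 U).op f = f := by
  rw [op_id, X.presheaf.map_id]
  rfl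

lemma Scheme.Modules.map_map (M : X.Modules) {U V W : X.Opens} (i : U ⟶ V) (j : V ⟶ W)
    (l : U ⟶ W) (x : Γ(M, W)) :
    M.presheaf.map i.op (M.presheaf.map j.op x) = M.presheaf.map l.op x := by
  rw [← ConcreteCategory.comp_apply, ← M.presheaf.map_comp]
  rfl

lemma Scheme.Modules.map_id_apply (M : X.Modules) {U : X.Opens} (x : Γ(M, U)) :
    M.presheaf.map (𝟙 U).op x = x := by
  rw [op_id, M.presheaf.map_id]
  rfl

namespace IsAffineOpen

variable {U : X.Opens} (hU : IsAffineOpen U)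

lemma fromSpec_image_top : hU.fromSpec ''ᵁ ⊤ = U := by
  simp

lemma ΓSpecIso_inv_appIso_inv (V : (Spec Γ(X, U)).Opens) (h : hU.fromSpec ''ᵁ V ≤ U)
    (a : Γ(X, U)) :
    (hU.fromSpec.appIso V).inv ((Spec Γ(X, U)).presheaf.map V.leTop.op
      ((Scheme.ΓSpecIso Γ(X, U)).inv a)) = X.presheaf.map (homOfLE h).op a := by
  have h₁ : V ≤ hU.fromSpec ⁻¹ᵁ U := by
    rw [hU.fromSpec_preimage_self]
    exact le_top
  have h₂ := hU.fromSpec.appLE_appIso_inv (U := U) (V := V) h₁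
  have h₃ : hU.fromSpec.appLE U V h₁ =
      (Scheme.ΓSpecIso Γ(X, U)).inv ≫ (Spec Γ(X, U)).presheaf.map V.leTop.op := by
    rw [Scheme.Hom.appLE, hU.fromSpec_app_self, Category.assoc, ← Functor.map_comp]
    rfl
  rw [h₃] at h₂
  exact congrArg (fun φ => φ.hom a) h₂

include hU in
open Scheme in
/-- The sections of a quasi-coherent module on the principal open subset of an affine open
subset defined by a function. -/
lemma isLocalizedModule_aux (M : X.Modules)
    (hM : SheafOfModules.IsQuasicoherent (R := X.ringCatSheaf) M) (f : Γ(X, U))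
    (i : X.basicOpen f ⟶ U) :
    (∀ y : Γ(M, X.basicOpen f), ∃ (n : ℕ) (x : Γ(M, U)),
      X.presheaf.map i.op f ^ n • y = M.presheaf.map i.op x) ∧
    ∀ x : Γ(M, U), M.presheaf.map i.op x = 0 → ∃ n : ℕ, f ^ n • x = 0 := by
  let N : (Spec Γ(X, U)).Modules := M.restrict hU.fromSpec
  have hN : IsIso N.fromTildeΓ := by
    have : SheafOfModules.IsQuasicoherent (R := (Spec Γ(X, U)).ringCatSheaf) N :=
      Modules.isQuasicoherent_restrictFunctor hU.fromSpec M
    exact Modules.isIso_fromTildeΓ_of_isQuasicoherent N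
  rw [isIso_fromTildeΓ_iff_isLocalizing] at hN
  obtain ⟨D, hD, hD_surj, hD_inj⟩ : ∃ (D : (Spec Γ(X, U)).Opens)
      (hD : hU.fromSpec ''ᵁ D = X.basicOpen f),
      (∀ y : Γ(M, hU.fromSpec ''ᵁ D), ∃ (n : ℕ) (x : Γ(M, hU.fromSpec ''ᵁ ⊤)),
        X.presheaf.map (homOfLE (hD.trans_le i.le)).op (f ^ n) • y =
          M.presheaf.map (homOfLE (hU.fromSpec.image_mono le_top)).op x) ∧
      ∀ x : Γ(M, hU.fromSpec ''ᵁ ⊤),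
        M.presheaf.map (homOfLE (hU.fromSpec.image_mono (le_top : D ≤ ⊤))).op x = 0 →
          ∃ n : ℕ, X.presheaf.map (homOfLE hU.fromSpec_image_top.le).op (f ^ n) • x = 0 := by
    have hD := hU.fromSpec_image_basicOpen f
    refine ⟨PrimeSpectrum.basicOpen f, hD, fun y => ?_, fun x hx => ?_⟩
    · obtain ⟨⟨x, ⟨_, n, rfl⟩⟩, h⟩ := (hN f).surj y
      refine ⟨n, x, ?_⟩
      exact (congrArg (· • y) (hU.ΓSpecIso_inv_appIso_inv _ _ _).symm).trans h
    · obtain ⟨⟨_, n, rfl⟩, h⟩ := (hN f).exists_of_eq (x₁ := x) (x₂ := 0) (hx.trans (map_zero _).symm)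
      refine ⟨n, ?_⟩
      exact (congrArg (· • x) (hU.ΓSpecIso_inv_appIso_inv _ _ _).symm).trans
        (h.trans (smul_zero _))
  have htop := hU.fromSpec_image_top
  constructor
  · intro y
    obtain ⟨n, x, h⟩ := hD_surj (M.presheaf.map (homOfLE hD.le).op y)
    refine ⟨n, M.presheaf.map (homOfLE htop.ge).op x, ?_⟩
    have h' := congrArg (M.presheaf.map (homOfLE hD.ge).op) h
    rw [Modules.map_smul, M.map_map _ _ (𝟙 _), M.map_id_apply, X.presheaf_map_map _ _ i,
      M.map_map _ _ (i ≫ homOfLE htop.ge)] at h'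
    rw [M.map_map _ _ (i ≫ homOfLE htop.ge), ← h', map_pow]
  · intro x hx
    obtain ⟨n, h⟩ := hD_inj (M.presheaf.map (homOfLE htop.le).op x) (by
      rw [M.map_map _ _ (homOfLE hD.le ≫ i), ← M.map_map (homOfLE hD.le) i, hx, map_zero])
    have h' := congrArg (M.presheaf.map (homOfLE htop.ge).op) h
    rw [Modules.map_smul, M.map_map _ _ (𝟙 _), M.map_id_apply, X.presheaf_map_map _ _ (𝟙 _),
      X.presheaf_map_id, map_zero] at h'
    exact ⟨n, h'⟩

end IsAffineOpen

end AlgebraicGeometry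

namespace LieAlgebroid

variable {k : Type u} [Field k] {X : Scheme.{u}} [X.Over (Spec (.of k))] (ℒ : LieAlgebroid k X)

lemma envRestrict_envRestrict {U V W : X.Opens} (i : U ⟶ V) (j : V ⟶ W) (l : U ⟶ W)
    (x : ℒ.EnvSections W) : ℒ.envRestrict i (ℒ.envRestrict j x) = ℒ.envRestrict l x :=
  LieRinehart.Env.map_map_of_eq _ _ _ (fun f => X.presheaf_map_map i j l f)
    (fun s => ℒ.carrier.map_map i j l s) x

lemma envRestrict_id {U : X.Opens} (i : U ⟶ U) (x : ℒ.EnvSections U) : ℒ.envRestrict i x = x :=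
  LieRinehart.Env.map_of_eq_id _ (fun f => X.presheaf_map_id f)
    (fun s => ℒ.carrier.map_id_apply s) x

/-- Over an affine open subset, the enveloping algebras form a quasi-coherent left module. -/
lemma envRestrict_basicOpen {U V : X.Opens} (hU : IsAffineOpen U) (f : Γ(X, U))
    (i : V ⟶ U) (hV : V = X.basicOpen f) :
    (∀ x, ℒ.envRestrict i x = 0 →
      ∃ n : ℕ, LieRinehart.Env.ofRing k _ (ℒ.Sections U) f ^ n * x = 0) ∧
    ∀ y, ∃ (n : ℕ) (x : ℒ.EnvSections U),
      LieRinehart.Env.ofRing k _ (ℒ.Sections V) (X.presheaf.map i.op f) ^ n * y =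
        ℒ.envRestrict i x := by
  let _ : Algebra Γ(X, U) Γ(X, V) := (X.presheaf.map i.op).hom.toAlgebra
  let _ : Module Γ(X, U) (ℒ.Sections V) := Module.compHom _ (X.presheaf.map i.op).hom
  have : IsScalarTower Γ(X, U) Γ(X, V) (ℒ.Sections V) := ⟨fun a b s => mul_smul _ _ s⟩
  have hloc : IsLocalization.Away f Γ(X, V) := hU.isLocalization_of_eq_basicOpen f i hV
  let F : ℒ.Sections U →ₗ[Γ(X, U)] ℒ.Sections V :=
    { toFun := fun s => ℒ.carrier.presheaf.map i.op s
      map_add' := fun s t => map_add _ s t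
      map_smul' := fun g s => ℒ.carrier.map_smul i g s }
  have hF : IsLocalizedModule (Submonoid.powers f) F := by
    have hM : SheafOfModules.IsQuasicoherent (R := X.ringCatSheaf) ℒ.carrier := by
      obtain ⟨σ, _⟩ := ℒ.coherent
      exact σ.isQuasicoherent
    subst hV
    obtain ⟨h_surj, h_inj⟩ := hU.isLocalizedModule_aux ℒ.carrier hM f i
    refine ⟨fun t => ?_, fun y => ?_, fun {s t} h => ?_⟩
    · rw [← (Algebra.lsmul Γ(X, U) (A := Γ(X, X.basicOpen f)) Γ(X, U)
        (ℒ.Sections (X.basicOpen f))).commutes]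
      exact (IsLocalization.map_units Γ(X, X.basicOpen f) t).map _
    · obtain ⟨n, x, h⟩ := h_surj y
      refine ⟨⟨x, ⟨f ^ n, n, rfl⟩⟩, Eq.trans ?_ h⟩
      rw [← map_pow]
      rfl
    · obtain ⟨n, hn⟩ := h_inj (s - t) (by rw [map_sub]; exact sub_eq_zero.mpr h)
      refine ⟨⟨f ^ n, n, rfl⟩, ?_⟩
      rw [smul_sub, sub_eq_zero] at hn
      exact hn
  constructor
  · intro x hx
    obtain ⟨_, ⟨n, rfl⟩, h⟩ := LieRinehart.Env.exists_mul_eq_zero_of_map_eq_zero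
      (Submonoid.powers f) (ℒ.restrict i) (fun _ => rfl) F (fun _ => rfl) hx
    exact ⟨n, by rw [← map_pow]; exact h⟩
  · exact LieRinehart.Env.exists_mul_eq_map (ℒ.restrict i) (fun _ => rfl) F (fun _ => rfl) f

lemma eq_of_envRestrict_eq {U : X.Opens} (hU : IsAffineOpen U) {x y : ℒ.EnvSections U}
    (h : ∀ p ∈ U, ∃ (W : X.Opens) (i : W ⟶ U), p ∈ W ∧ ℒ.envRestrict i x = ℒ.envRestrict i y) :
    x = y := by
  let s : Set Γ(X, U) := {f | ℒ.envRestrict (homOfLE (X.basicOpen_le f)) (x - y) = 0}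
  have hs : Ideal.span s = ⊤ := by
    rw [← hU.iSup_basicOpen_eq_self_iff]
    refine le_antisymm (iSup_le fun f => X.basicOpen_le _) fun p hp => ?_
    obtain ⟨W, i, hpW, hi⟩ := h p hp
    obtain ⟨f, hf, hpf⟩ := hU.exists_basicOpen_le ⟨p, hpW⟩ hp
    refine Opens.mem_iSup.mpr ⟨⟨f, ?_⟩, hpf⟩
    change ℒ.envRestrict _ (x - y) = 0
    rw [← ℒ.envRestrict_envRestrict (homOfLE hf) i, map_sub, hi, sub_self, map_zero]
  rw [← sub_eq_zero]
  exact eq_zero_of_pow_mul_eq_zero _ hs fun f hf =>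
    (ℒ.envRestrict_basicOpen hU f (homOfLE (X.basicOpen_le f)) rfl).1 _ hf

lemma exists_glue_env {U : X.Opens} (hU : IsAffineOpen U) {s : Set Γ(X, U)} (hs : s.Finite)
    (hs' : Ideal.span s = ⊤) (e : ∀ f : s, ℒ.EnvSections (X.basicOpen f.1))
    (he : ∀ f g : s, ∀ (i : X.basicOpen (f.1 * g.1) ⟶ X.basicOpen f.1)
      (j : X.basicOpen (f.1 * g.1) ⟶ X.basicOpen g.1),
      ℒ.envRestrict i (e f) = ℒ.envRestrict j (e g)) :
    ∃ x : ℒ.EnvSections U, ∀ f : s,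
      ℒ.envRestrict (homOfLE (X.basicOpen_le f.1)) x = e f := by
  have := hs.to_subtype
  have hl (f g : s) : X.basicOpen (f.1 * g.1) ≤ X.basicOpen f.1 := by
    rw [X.basicOpen_mul]
    exact inf_le_left
  have hr (f g : s) : X.basicOpen (f.1 * g.1) ≤ X.basicOpen g.1 := by
    rw [X.basicOpen_mul]
    exact inf_le_right
  have hofRing (f : s) (g : Γ(X, U)) : ℒ.envRestrict (homOfLE (X.basicOpen_le f.1))
      (LieRinehart.Env.ofRing k _ (ℒ.Sections U) g) =
      LieRinehart.Env.ofRing k _ (ℒ.Sections _) (X.presheaf.map (homOfLE (X.basicOpen_le f.1)).op g) :=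
    LieRinehart.Env.map_ofRing (ℒ.restrict _) g
  refine exists_glue_of_span_eq_top (LieRinehart.Env.ofRing k Γ(X, U) (ℒ.Sections U))
    (f := fun f : s => f.1) (by simpa using hs')
    (fun f => (ℒ.envRestrict (homOfLE (X.basicOpen_le f.1))).toRingHom)
    (fun f g => (ℒ.envRestrict (homOfLE (hl f g))).toRingHom)
    (fun f g => (ℒ.envRestrict (homOfLE (hr f g))).toRingHom)
    (fun f g x => ?_) (fun f => ?_) (fun f y => ?_) (fun f g x hx => ?_) e (fun f g => he f g _ _)
  · exact (ℒ.envRestrict_envRestrict _ _ (homOfLE (X.basicOpen_le _)) x).trans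
      (ℒ.envRestrict_envRestrict _ _ _ x).symm
  · change IsUnit (ℒ.envRestrict _ _)
    rw [hofRing]
    exact (X.toRingedSpace.isUnit_res_basicOpen f.1).map _
  · obtain ⟨n, x, h⟩ := (ℒ.envRestrict_basicOpen hU f.1 (homOfLE (X.basicOpen_le f.1)) rfl).2 y
    rw [← hofRing] at h
    exact ⟨n, x, h⟩
  · refine (ℒ.envRestrict_basicOpen hU (f.1 * g.1) (homOfLE (X.basicOpen_le _)) rfl).1 x ?_
    exact (ℒ.envRestrict_envRestrict _ _ _ x).symm.trans hx

lemma envEval_bijective (U : X.affineOpens) : Function.Bijective (ℒ.envEval U) := by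
  constructor
  · intro u v h
    ext W
    have hu := u.2 ⟨U, le_rfl⟩ W (homOfLE W.2)
    have hv := v.2 ⟨U, le_rfl⟩ W (homOfLE W.2)
    rw [← hu, ← hv]
    exact congrArg _ h
  · intro x
    refine ⟨⟨fun W => ℒ.envRestrict (homOfLE W.2) x, fun W W' i =>
      ℒ.envRestrict_envRestrict _ _ _ x⟩, ?_⟩
    exact ℒ.envRestrict_id _ x

lemma exists_glue_envGlued {ι : Type*} (V : ι → X.Opens) (u : ∀ i, ℒ.envGlued (V i))
    (hu : ∀ i j (W : X.affineOpens) (hi : W.1 ≤ V i) (hj : W.1 ≤ V j),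
      (u i).1 ⟨W, hi⟩ = (u j).1 ⟨W, hj⟩) (U : X.affineOpens) (hU : U.1 ≤ iSup V) :
    ∃ x : ℒ.EnvSections U.1, ∀ i (W : X.affineOpens) (hW : W.1 ≤ V i) (j : W.1 ⟶ U.1),
      ℒ.envRestrict j x = (u i).1 ⟨W, hW⟩ := by
  let s : Set Γ(X, U.1) := {f | ∃ i, X.basicOpen f ≤ V i}
  have hs : Ideal.span s = ⊤ := by
    rw [← U.2.iSup_basicOpen_eq_self_iff]
    refine le_antisymm (iSup_le fun f => X.basicOpen_le _) fun p hp => ?_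
    obtain ⟨i, hi⟩ := Opens.mem_iSup.mp (hU hp)
    obtain ⟨f, hf, hpf⟩ := U.2.exists_basicOpen_le ⟨p, hi⟩ hp
    exact Opens.mem_iSup.mpr ⟨⟨f, i, hf⟩, hpf⟩
  obtain ⟨t, hts, ht⟩ := (Ideal.span_eq_top_iff_finite s).mp hs
  choose a ha using fun f : (t : Set Γ(X, U.1)) => hts f.2
  obtain ⟨x, hx⟩ := ℒ.exists_glue_env U.2 t.finite_toSet ht
    (fun f => (u (a f)).1 ⟨⟨_, U.2.basicOpen f.1⟩, ha f⟩) (fun f g i j => by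
      rw [(u (a f)).2 ⟨⟨_, U.2.basicOpen f.1⟩, ha f⟩
          ⟨⟨_, U.2.basicOpen (f.1 * g.1)⟩, i.le.trans (ha f)⟩ i,
        (u (a g)).2 ⟨⟨_, U.2.basicOpen g.1⟩, ha g⟩
          ⟨⟨_, U.2.basicOpen (f.1 * g.1)⟩, j.le.trans (ha g)⟩ j]
      exact hu _ _ _ _ _)
  refine ⟨x, fun i W hW j => ℒ.eq_of_envRestrict_eq W.2 fun p hp => ?_⟩
  have hp' : p ∈ ⨆ f : (t : Set Γ(X, U.1)), X.basicOpen f.1 := by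
    rw [U.2.iSup_basicOpen_eq_self_iff.mpr ht]
    exact j.le hp
  obtain ⟨f, hf⟩ := Opens.mem_iSup.mp hp'
  obtain ⟨D, hD, hpD, hDle⟩ := exists_isAffineOpen_mem_and_subset (U := W.1 ⊓ X.basicOpen f.1) ⟨hp, hf⟩
  refine ⟨D, homOfLE (hDle.trans inf_le_left), hpD, ?_⟩
  rw [(u i).2 ⟨W, hW⟩ ⟨⟨D, hD⟩, (hDle.trans inf_le_left).trans hW⟩,
    ℒ.envRestrict_envRestrict _ _ (homOfLE (hDle.trans inf_le_right) ≫
      homOfLE (X.basicOpen_le f.1)),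
    ← ℒ.envRestrict_envRestrict (homOfLE (hDle.trans inf_le_right)), hx,
    (u (a f)).2 ⟨⟨_, U.2.basicOpen f.1⟩, ha f⟩
      ⟨⟨D, hD⟩, (hDle.trans inf_le_right).trans (ha f)⟩]
  exact hu _ _ _ _ _

theorem envIsSheaf : ℒ.EnvIsSheaf := by
  refine (TopCat.Presheaf.isSheaf_iff_isSheafUniqueGluing ℒ.envPresheaf).mpr ?_
  intro ι V u hu
  have hu' (i j) (W : X.affineOpens) (hi : W.1 ≤ V i) (hj : W.1 ≤ V j) :
      (u i).1 ⟨W, hi⟩ = (u j).1 ⟨W, hj⟩ :=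
    congrArg (fun v : ℒ.envGlued (V i ⊓ V j) => v.1 ⟨W, le_inf hi hj⟩) (hu i j)
  choose x hx using fun U : {U : X.affineOpens // U.1 ≤ iSup V} =>
    ℒ.exists_glue_envGlued V u hu' U.1 U.2
  have hx_unique (U : {U : X.affineOpens // U.1 ≤ iSup V}) (y : ℒ.EnvSections U.1.1)
      (hy : ∀ i (W : X.affineOpens) (hW : W.1 ≤ V i) (j : W.1 ⟶ U.1.1),
        ℒ.envRestrict j y = (u i).1 ⟨W, hW⟩) : y = x U := by
    refine ℒ.eq_of_envRestrict_eq U.1.2 fun p hp => ?_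
    obtain ⟨i, hi⟩ := Opens.mem_iSup.mp (U.2 hp)
    obtain ⟨D, hD, hpD, hDle⟩ := exists_isAffineOpen_mem_and_subset (U := U.1.1 ⊓ V i) ⟨hp, hi⟩
    refine ⟨D, homOfLE (hDle.trans inf_le_left), hpD, ?_⟩
    rw [hy i ⟨D, hD⟩ (hDle.trans inf_le_right), hx U i ⟨D, hD⟩ (hDle.trans inf_le_right)]
  refine ⟨(⟨x, fun U W i => ?_⟩ : ℒ.envGlued (iSup V)), fun i => ?_, fun v hv => ?_⟩
  · refine hx_unique W _ fun a D hD j => ?_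
    rw [ℒ.envRestrict_envRestrict _ _ (j ≫ i)]
    exact hx U a D hD _
  · refine Subtype.ext (funext fun U => ?_)
    have := hx ⟨U.1, U.2.trans (le_iSup V i)⟩ i U.1 U.2 (𝟙 _)
    rw [ℒ.envRestrict_id] at this
    exact this
  · refine Subtype.ext (funext fun U => hx_unique U _ fun i W hW j => ?_)
    have h₁ := v.2 U ⟨W, hW.trans (le_iSup V i)⟩ j
    exact h₁.trans (congrArg (fun w : ℒ.envGlued (V i) => w.1 ⟨W, hW⟩) (hv i))

end LieAlgebroid

lemma AlgebraicGeometry.Scheme.Modules.eq_of_map_affine_eq {X : Scheme.{u}} (M : X.Modules)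
    {V : X.Opens} {x y : Γ(M, V)}
    (h : ∀ (U : X.affineOpens) (i : U.1 ⟶ V), M.presheaf.map i.op x = M.presheaf.map i.op y) :
    x = y := by
  refine TopCat.Sheaf.eq_of_locally_eq' ⟨M.presheaf, M.isSheaf⟩
    (fun U : {U : X.affineOpens // U.1 ≤ V} => U.1.1) V (fun U => homOfLE U.2) (fun p hp => ?_) x y
    fun U => h U.1 (homOfLE U.2)
  obtain ⟨W, hW, hpW, hWV⟩ := exists_isAffineOpen_mem_and_subset hp
  exact Opens.mem_iSup.mpr ⟨⟨⟨W, hW⟩, hWV⟩, hpW⟩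

namespace LieAlgebroid

variable {k : Type u} [Field k] {X : Scheme.{u}} [X.Over (Spec (.of k))] {ℒ : LieAlgebroid k X}

namespace Rep

variable (M : ℒ.Rep)

lemma exists_envAction (U : X.Opens) :
    ∃ Φ : ℒ.EnvSections U →+* AddMonoid.End Γ(M.carrier, U),
      (∀ f m, Φ (LieRinehart.Env.ofRing k _ (ℒ.Sections U) f) m = f • m) ∧
      ∀ s m, Φ (LieRinehart.Env.ofLie k _ (ℒ.Sections U) s) m = M.ρ U s m := by
  let _ : Module k Γ(M.carrier, U) := Module.compHom _ (algebraMap k Γ(X, U))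
  have : IsScalarTower k Γ(X, U) Γ(M.carrier, U) := ⟨fun c f m => by
    rw [Algebra.smul_def, mul_smul]
    rfl⟩
  have ρ_smul (s : ℒ.Sections U) (c : k) (m : Γ(M.carrier, U)) :
      M.ρ U s (c • m) = c • M.ρ U s m := by
    refine (M.leibniz U s (algebraMap k Γ(X, U) c) m).trans ?_
    rw [Derivation.map_algebraMap, zero_smul, add_zero]
    rfl
  obtain ⟨Φ, h, h'⟩ := LieRinehart.Env.exists_lift (k := k) (A := Γ(X, U)) (L := ℒ.Sections U)
    (B := Module.End k Γ(M.carrier, U)) (Algebra.lsmul k (A := Γ(X, U)) k Γ(M.carrier, U))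
    (AddMonoidHom.mk' (fun s => { toFun := M.ρ U s, map_add' := map_add _, map_smul' := ρ_smul s })
      fun s t => by
        ext m
        exact congrArg (fun ψ => ψ m) (map_add (M.ρ U) s t))
    (fun f s => by
      ext m
      exact M.smul U f s m)
    (fun s f => by
      ext m
      exact M.leibniz U s f m)
    (fun s t => by
      ext m
      exact M.bracket U s t m)
  refine ⟨(Module.toAddMonoidEnd (Module.End k Γ(M.carrier, U)) Γ(M.carrier, U)).comp Φ.toRingHom,
    fun f m => ?_, fun s m => ?_⟩
  · exact congrArg (fun ψ => ψ m) (h f)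
  · exact congrArg (fun ψ => ψ m) (h' s)

/-- The action of the enveloping algebra of the sections of `ℒ` on the sections of a
representation. -/
def envAction (U : X.Opens) : ℒ.EnvSections U →+* AddMonoid.End Γ(M.carrier, U) :=
  (M.exists_envAction U).choose

lemma envAction_ofRing (U : X.Opens) (f : Γ(X, U)) (m : Γ(M.carrier, U)) :
    M.envAction U (LieRinehart.Env.ofRing k _ (ℒ.Sections U) f) m = f • m :=
  (M.exists_envAction U).choose_spec.1 f m

lemma envAction_ofLie (U : X.Opens) (s : ℒ.Sections U) (m : Γ(M.carrier, U)) :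
    M.envAction U (LieRinehart.Env.ofLie k _ (ℒ.Sections U) s) m = M.ρ U s m :=
  (M.exists_envAction U).choose_spec.2 s m

lemma envAction_add (U : X.Opens) (x y : ℒ.EnvSections U) (m : Γ(M.carrier, U)) :
    M.envAction U (x + y) m = M.envAction U x m + M.envAction U y m :=
  congrArg (fun ψ => ψ m) (map_add (M.envAction U) x y)

lemma envAction_mul (U : X.Opens) (x y : ℒ.EnvSections U) (m : Γ(M.carrier, U)) :
    M.envAction U (x * y) m = M.envAction U x (M.envAction U y m) :=
  congrArg (fun ψ => ψ m) (map_mul (M.envAction U) x y)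

lemma map_envAction {U V : X.Opens} (i : U ⟶ V) (x : ℒ.EnvSections V) (m : Γ(M.carrier, V)) :
    M.carrier.presheaf.map i.op (M.envAction V x m) =
      M.envAction U (ℒ.envRestrict i x) (M.carrier.presheaf.map i.op m) := by
  induction x using LieRinehart.Env.induction generalizing m with
  | h_ring f =>
    rw [envAction_ofRing, Scheme.Modules.map_smul, ← envAction_ofRing]
    exact congrArg (fun y => M.envAction U y _) (LieRinehart.Env.map_ofRing (ℒ.restrict i) f).symm
  | h_lie s =>
    rw [envAction_ofLie, M.restrict, ← envAction_ofLie]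
    exact congrArg (fun y => M.envAction U y _) (LieRinehart.Env.map_ofLie (ℒ.restrict i) s).symm
  | h_add x y hx hy =>
    rw [envAction_add, map_add, map_add, envAction_add, hx, hy]
  | h_mul x y hx hy =>
    rw [envAction_mul, map_mul, envAction_mul, hx, hy]

lemma exists_envGlued_smul {V : X.Opens} (u : ℒ.envGlued V) (m : Γ(M.carrier, V)) :
    ∃ n : Γ(M.carrier, V), ∀ U : {U : X.affineOpens // U.1 ≤ V},
      M.carrier.presheaf.map (homOfLE U.2).op n =
        M.envAction U.1.1 (u.1 U) (M.carrier.presheaf.map (homOfLE U.2).op m) := by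
  refine (TopCat.Sheaf.existsUnique_gluing' ⟨M.carrier.presheaf, M.carrier.isSheaf⟩
    (fun U : {U : X.affineOpens // U.1 ≤ V} => U.1.1) V (fun U => homOfLE U.2) (fun p hp => ?_)
    (fun U => M.envAction U.1.1 (u.1 U) (M.carrier.presheaf.map (homOfLE U.2).op m))
    fun U U' => ?_).exists
  · obtain ⟨W, hW, hpW, hWV⟩ := exists_isAffineOpen_mem_and_subset hp
    exact Opens.mem_iSup.mpr ⟨⟨⟨W, hW⟩, hWV⟩, hpW⟩
  · refine M.carrier.eq_of_map_affine_eq fun W i => ?_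
    have h (U : {U : X.affineOpens // U.1 ≤ V}) (j : W.1 ⟶ U.1.1) :
        M.carrier.presheaf.map j.op
          (M.envAction U.1.1 (u.1 U) (M.carrier.presheaf.map (homOfLE U.2).op m)) =
        M.envAction W.1 (u.1 ⟨W, j.le.trans U.2⟩)
          (M.carrier.presheaf.map (homOfLE (j.le.trans U.2)).op m) := by
      rw [map_envAction, u.2 U ⟨W, j.le.trans U.2⟩, M.carrier.map_map]
    exact (M.carrier.map_map _ _ (i ≫ homOfLE inf_le_left) _).trans ((h U _).trans
      ((M.carrier.map_map _ _ (i ≫ homOfLE inf_le_right) _).trans (h U' _)).symm)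

/-- The sections of a representation on an open subset form a left module over the sections
of the universal enveloping algebroid. -/
@[reducible]
def envModule (V : X.Opens) : Module (ℒ.envGlued V) Γ(M.carrier, V) :=
  let _ : SMul (ℒ.envGlued V) Γ(M.carrier, V) :=
    ⟨fun u m => (M.exists_envGlued_smul u m).choose⟩
  have spec (u : ℒ.envGlued V) (m : Γ(M.carrier, V)) (U : X.affineOpens) (i : U.1 ⟶ V) :
      M.carrier.presheaf.map i.op (u • m) =
        M.envAction U.1 (u.1 ⟨U, i.le⟩) (M.carrier.presheaf.map i.op m) :=
    (M.exists_envGlued_smul u m).choose_spec ⟨U, i.le⟩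
  Module.ofMinimalAxioms
    (fun u m n => M.carrier.eq_of_map_affine_eq fun U i => by
      rw [map_add, spec, spec, spec, map_add, map_add])
    (fun u v m => M.carrier.eq_of_map_affine_eq fun U i => by
      rw [map_add, spec, spec, spec, ← envAction_add]
      rfl)
    (fun u v m => M.carrier.eq_of_map_affine_eq fun U i => by
      rw [spec, spec, spec, ← envAction_mul]
      rfl)
    (fun m => M.carrier.eq_of_map_affine_eq fun U i => by
      rw [spec]
      exact congrArg (fun ψ => ψ (M.carrier.presheaf.map i.op m)) (map_one (M.envAction U.1)))

attribute [local instance] envModule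

lemma map_envGlued_smul {V : X.Opens} (u : ℒ.envGlued V) (m : Γ(M.carrier, V))
    (U : X.affineOpens) (i : U.1 ⟶ V) : M.carrier.presheaf.map i.op (u • m) =
      M.envAction U.1 (u.1 ⟨U, i.le⟩) (M.carrier.presheaf.map i.op m) :=
  (M.exists_envGlued_smul u m).choose_spec ⟨U, i.le⟩

lemma envGluedRestrict_smul {U V : X.Opens} (i : U ⟶ V) (u : ℒ.envGlued V)
    (m : Γ(M.carrier, V)) : M.carrier.presheaf.map i.op (u • m) =
      ℒ.envGluedRestrict i.le u • M.carrier.presheaf.map i.op m := by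
  refine M.carrier.eq_of_map_affine_eq fun W j => ?_
  rw [map_envGlued_smul, M.carrier.map_map _ _ (j ≫ i), M.carrier.map_map _ _ (j ≫ i),
    map_envGlued_smul]
  rfl

lemma envOfRing_smul {V : X.Opens} (f : Γ(X, V)) (m : Γ(M.carrier, V)) :
    ℒ.envOfRing V f • m = f • m := by
  refine M.carrier.eq_of_map_affine_eq fun U i => ?_
  rw [map_envGlued_smul, Scheme.Modules.map_smul]
  exact M.envAction_ofRing U.1 _ _

lemma envOfLie_smul {V : X.Opens} (s : ℒ.Sections V) (m : Γ(M.carrier, V)) :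
    ℒ.envOfLie V s • m = M.ρ V s m := by
  refine M.carrier.eq_of_map_affine_eq fun U i => ?_
  rw [map_envGlued_smul, M.restrict]
  exact M.envAction_ofLie U.1 _ _

/-- The left module over the universal enveloping algebroid defined by a representation. -/
def toEnvMod (h : ℒ.EnvIsSheaf) : EnvMod h where
  val :=
    letI (V : (X.Opens)ᵒᵖ) : Module ((envSheaf h).obj.obj V) (M.carrier.presheaf.obj V) :=
      M.envModule V.unop
    PresheafOfModules.ofPresheaf (R := (envSheaf h).obj) M.carrier.presheaf
      fun {_ _} i u m => M.envGluedRestrict_smul i.unop u m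
  isSheaf := M.carrier.isSheaf

/-- The representation defined by the module `toEnvMod` is the original one. -/
def toEnvModIso (h : ℒ.EnvIsSheaf) : (repOfEnvMod h).obj (M.toEnvMod h) ≅ M where
  hom :=
    { hom := ⟨PresheafOfModules.homMk (𝟙 M.carrier.presheaf) fun _ f m =>
        M.envOfRing_smul f m⟩
      comm := fun _ s m => (M.envOfLie_smul s m).symm }
  inv :=
    { hom := ⟨PresheafOfModules.homMk (𝟙 M.carrier.presheaf) fun _ f m =>
        (M.envOfRing_smul f m).symm⟩
      comm := fun _ s m => M.envOfLie_smul s m }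
  hom_inv_id := rfl
  inv_hom_id := rfl

end Rep

end LieAlgebroid

namespace LieAlgebroid

variable {k : Type u} [Field k] {X : Scheme.{u}} [X.Over (Spec (.of k))] {ℒ : LieAlgebroid k X}

variable (ℒ) in
lemma envEval_envOfRing (U : X.affineOpens) (f : Γ(X, U.1)) :
    ℒ.envEval U (ℒ.envOfRing U.1 f) = LieRinehart.Env.ofRing k _ (ℒ.Sections U.1) f :=
  congrArg (LieRinehart.Env.ofRing k Γ(X, U.1) (ℒ.Sections U.1)) (X.presheaf_map_id f)

variable (ℒ) in
lemma envEval_envOfLie (U : X.affineOpens) (s : ℒ.Sections U.1) :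
    ℒ.envEval U (ℒ.envOfLie U.1 s) = LieRinehart.Env.ofLie k _ (ℒ.Sections U.1) s :=
  congrArg (LieRinehart.Env.ofLie k Γ(X, U.1) (ℒ.Sections U.1)) (ℒ.carrier.map_id_apply s)

section

variable {h : ℒ.EnvIsSheaf} {N N' : EnvMod h}
  (φ : (envModToModules h).obj N ⟶ (envModToModules h).obj N')

/-- Linear maps which commute with the action of `ℒ` commute with that of the enveloping algebroid
over affine open subsets. -/
lemma hom_app_smul_of_affine
    (hφ : ∀ (V : X.Opens) (s : ℒ.Sections V) (n : Γ((envModToModules h).obj N, V)),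
      φ.app V (ℒ.envOfLie V s • n) = ℒ.envOfLie V s • φ.app V n)
    (U : X.affineOpens) (u : ℒ.envGlued U.1)
    (n : Γ((envModToModules h).obj N, U.1)) :
    φ.app U.1 (u • n) = u • φ.app U.1 n := by
  generalize hx : ℒ.envEval U u = x
  induction x using LieRinehart.Env.induction generalizing u n with
  | h_ring f =>
    obtain rfl : u = ℒ.envOfRing U.1 f :=
      (ℒ.envEval_bijective U).1 (hx.trans (ℒ.envEval_envOfRing U f).symm)
    exact φ.app_smul f n
  | h_lie s =>
    obtain rfl : u = ℒ.envOfLie U.1 s :=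
      (ℒ.envEval_bijective U).1 (hx.trans (ℒ.envEval_envOfLie U s).symm)
    exact hφ U.1 s n
  | h_add x y hx' hy' =>
    obtain ⟨v, hv⟩ := (ℒ.envEval_bijective U).2 x
    obtain ⟨w, hw⟩ := (ℒ.envEval_bijective U).2 y
    obtain rfl : u = v + w :=
      (ℒ.envEval_bijective U).1 (by rw [hx, map_add, hv, hw])
    rw [add_smul, map_add, hx' v n hv, hy' w n hw, add_smul]
  | h_mul x y hx' hy' =>
    obtain ⟨v, hv⟩ := (ℒ.envEval_bijective U).2 x
    obtain ⟨w, hw⟩ := (ℒ.envEval_bijective U).2 y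
    obtain rfl : u = v * w :=
      (ℒ.envEval_bijective U).1 (by rw [hx, map_mul, hv, hw])
    rw [mul_smul, hx' v _ hv, hy' w n hw, mul_smul]

lemma hom_app_smul
    (hφ : ∀ (V : X.Opens) (s : ℒ.Sections V) (n : Γ((envModToModules h).obj N, V)),
      φ.app V (ℒ.envOfLie V s • n) = ℒ.envOfLie V s • φ.app V n)
    (V : X.Opens) (u : ℒ.envGlued V) (n : Γ((envModToModules h).obj N, V)) :
    φ.app V (u • n) = u • φ.app V n := by
  refine ((envModToModules h).obj N').eq_of_map_affine_eq fun U i => ?_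
  have hm (m : Γ((envModToModules h).obj N, V)) :
      ((envModToModules h).obj N').presheaf.map i.op (φ.app V m) =
        φ.app U.1 (((envModToModules h).obj N).presheaf.map i.op m) :=
    (congrArg (fun ψ => ψ m) (φ.mapPresheaf.naturality i.op)).symm
  rw [envMod_restrict_smul, hm, hm, envMod_restrict_smul, hom_app_smul_of_affine φ hφ]

end

instance (h : ℒ.EnvIsSheaf) : (repOfEnvMod h).Faithful where
  map_injective {N N'} φ ψ hφψ := by
    have h₁ : (envModToModules h).map φ = (envModToModules h).map ψ := congrArg Rep.Hom.hom hφψ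
    refine SheafOfModules.hom_ext (PresheafOfModules.hom_ext fun V => ?_)
    ext n
    exact congrArg (fun χ : (envModToModules h).obj N ⟶ (envModToModules h).obj N' =>
      χ.app V.unop n) h₁

instance (h : ℒ.EnvIsSheaf) : (repOfEnvMod h).Full where
  map_surjective φ :=
    ⟨⟨PresheafOfModules.homMk φ.hom.mapPresheaf fun V u n =>
      hom_app_smul φ.hom (fun V s n => (φ.comm V s n).symm) V.unop u n⟩, rfl⟩

instance (h : ℒ.EnvIsSheaf) : (repOfEnvMod h).EssSurj where
  mem_essImage M := ⟨M.toEnvMod h, ⟨M.toEnvModIso h⟩⟩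

instance (h : ℒ.EnvIsSheaf) : (repOfEnvMod h).IsEquivalence where

instance (h : ℒ.EnvIsSheaf) : (coherentRepOfEnvMod h).IsEquivalence where
  faithful :=
    have : ((envModIsCoherent h).ι ⋙ repOfEnvMod h).Faithful := Functor.Faithful.comp _ _
    Functor.Faithful.of_comp_iso ((Rep.isCoherent ℒ).liftCompιIso _ _)
  full :=
    have : ((envModIsCoherent h).ι ⋙ repOfEnvMod h).Full := Functor.Full.comp _ _
    Functor.Full.of_comp_faithful_iso ((Rep.isCoherent ℒ).liftCompιIso _ _)
  essSurj := ⟨fun M => by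
    have hM : envModIsCoherent h (M.obj.toEnvMod h) :=
      (SheafOfModules.isFinitePresentation X.ringCatSheaf).prop_of_iso
        ((Rep.forget ℒ).mapIso (M.obj.toEnvModIso h)).symm M.property
    exact ⟨⟨_, hM⟩, ⟨(Rep.isCoherent ℒ).isoMk (M.obj.toEnvModIso h)⟩⟩⟩

end LieAlgebroid

end

theorem mainTheorem8 (k : Type u) [Field k] (X : Scheme.{u}) [X.Over (Spec (.of k))]
    [IsNoetherian X] [X.IsSeparated] (ℒ : LieAlgebroid k X)
    (hfree : SheafOfModules.IsLocallyFree (R := X.ringCatSheaf) ℒ.carrier) :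
    ∃ h : ℒ.EnvIsSheaf,
      (∀ U : X.affineOpens, Function.Bijective (ℒ.envEval U)) ∧
      (LieAlgebroid.repOfEnvMod h).IsEquivalence ∧
      (LieAlgebroid.coherentRepOfEnvMod h).IsEquivalence :=
  ⟨ℒ.envIsSheaf, ℒ.envEval_bijective, inferInstance, inferInstance⟩
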